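/- Consider the Gaussian diamond network with $N\ge 1$ relays: the source sends $X_s$, relay $i\in[N]=\{1,\dots,N\}$ sends $X_i$, relay $i$ receives $Y_i=h_{is}X_s+Z_i$ and the destination receives $Y_d=\sum_{i=1}^N h_{id}X_i+Z$. The channel coefficients $h_{is},h_{id}\in\mathbb C$ are arbitrary, and the noises $Z,Z_1,\dots,Z_N$ are independent circularly symmetric complex Gaussian variables of variance $N_0W$ (noise power spectral density $N_0/2$, bandwidth $W$; $N_0,W>0$), independent of the inputs. Every node is subject to the average power constraint $P>0$, and $\mathrm{SNR}=P/(N_0W)$. The cut-set bound of the network, in bits, is $$\overline C=\sup_{(X_s,X_1,\dots,X_N)}\ \min_{\Lambda\subseteq[N]} I\big(X_s,X_\Lambda;\,Y_d,Y_{\overline\Lambda}\,\big|\,X_{\overline\Lambda}\big),\qquad \overline\Lambda=[N]\setminus\Lambda,$$ where the supremum is over all joint distributions of the complex random variables $X_s,X_1,\dots,X_N$ with $\mathbb E|X_s|^2\le P$ and $\mathbb E|X_i|^2\le P$ for all $i$. With $R_{is}=\log_2(1+\mathrm{SNR}\,|h_{is}|^2)$ and $R_{id}=\log_2(1+\mathrm{SNR}\,|h_{id}|^2)$,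 put $$\omega=\min_{\Lambda\subseteq[N]}\Big(\max_{i\in\Lambda}R_{id}+\max_{i\in\overline\Lambda}R_{is}\Big),\qquad G=\max\Big(3\log_2N-\log_2\tfrac{27}{4},\ 2\log_2N\Big),$$ where a maximum over the empty set is $0$. Then $\overline C$ is finite and $$\omega\le\overline C\le\omega+G.$$ -/

import Mathlib

open MeasureTheory ProbabilityTheory InformationTheory
open scoped ENNReal NNReal

noncomputable section

/-- The law `CN(0, v)` of a circularly symmetric complex Gaussian variable of variance `v`:
its real and imaginary parts are independent real Gaussians `N(0, v / 2)`. -/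
def complexGaussian (v : ℝ≥0) : Measure ℂ :=
  ((gaussianReal 0 (v / 2)).prod (gaussianReal 0 (v / 2))).map
    Complex.measurableEquivRealProd.symm

instance (v : ℝ≥0) : IsProbabilityMeasure (complexGaussian v) :=
  Measure.isProbabilityMeasure_map Complex.measurableEquivRealProd.symm.measurable.aemeasurable

/-- Conditional mutual information `I(X; Y | Z)` in nats, for random variables on a probability
space with law `μ`: the Kullback-Leibler divergence of the joint law `P_{ZXY}` from
`P_Z ⊗ (P_{X|Z} × P_{Y|Z})`, that is, the law under which `X` and `Y` are conditionally independent
given `Z` and the pairs `(Z, X)` and `(Z, Y)` have their true laws. -/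
def condMutualInfo {Ω α β γ : Type*} [MeasurableSpace Ω]
    [MeasurableSpace α] [StandardBorelSpace α] [Nonempty α]
    [MeasurableSpace β] [StandardBorelSpace β] [Nonempty β] [MeasurableSpace γ]
    (X : Ω → α) (Y : Ω → β) (Z : Ω → γ) (μ : Measure Ω) [IsFiniteMeasure μ] : ℝ≥0∞ :=
  klDiv (μ.map (fun w => (Z w, X w, Y w)))
    ((μ.map Z) ⊗ₘ (condDistrib X Z μ ×ₖ condDistrib Y Z μ))

/-- A Gaussian diamond network with `N` relays: the channel coefficients, the average power
constraint `P` of every node, the noise level `N₀` (the noise has power spectral density `N₀ / 2`)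
and the bandwidth `W`. -/
structure DiamondNetwork (N : ℕ) where
  /-- `hs i`: the coefficient of the channel from the source to relay `i`. -/
  hs : Fin N → ℂ
  /-- `hd i`: the coefficient of the channel from relay `i` to the destination. -/
  hd : Fin N → ℂ
  /-- The power constraint. -/
  P : ℝ
  /-- The noise level. -/
  N₀ : ℝ
  /-- The bandwidth. -/
  W : ℝ
  P_pos : 0 < P
  N₀_pos : 0 < N₀
  W_pos : 0 < W

namespace DiamondNetwork

variable {N : ℕ}

/-- The signals `(X_s, (X_i)_i)` sent by the source and by the relays. -/
abbrev Inputs (N : ℕ) : Type := ℂ × (Fin N → ℂ)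

/-- The noises `(Z, (Z_i)_i)` at the destination and at the relays. -/
abbrev Noises (N : ℕ) : Type := ℂ × (Fin N → ℂ)

/-- `SNR = P / (N₀ W)`. -/
def snr (net : DiamondNetwork N) : ℝ := net.P / (net.N₀ * net.W)

/-- The law of the noises: they are i.i.d. `CN(0, N₀ W)`. -/
def noiseLaw (net : DiamondNetwork N) : Measure (Noises N) :=
  (complexGaussian (net.N₀ * net.W).toNNReal).prod
    (Measure.pi fun _ : Fin N => complexGaussian (net.N₀ * net.W).toNNReal)

instance (net : DiamondNetwork N) : IsProbabilityMeasure net.noiseLaw := by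
  unfold noiseLaw; infer_instance

/-- The joint law of inputs and noises when the inputs have law `μ`: they are independent. -/
def jointLaw (net : DiamondNetwork N) (μ : ProbabilityMeasure (Inputs N)) :
    Measure (Inputs N × Noises N) :=
  (μ : Measure (Inputs N)).prod net.noiseLaw

instance (net : DiamondNetwork N) (μ : ProbabilityMeasure (Inputs N)) :
    IsProbabilityMeasure (net.jointLaw μ) := by
  unfold jointLaw; infer_instance

/-- The signal `Y_i = h_{is} X_s + Z_i` received by relay `i`. -/
def relayOutput (net : DiamondNetwork N) (i : Fin N) (w : Inputs N × Noises N) : ℂ :=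
  net.hs i * w.1.1 + w.2.2 i

/-- The signal `Y_d = ∑ i, h_{id} X_i + Z` received by the destination. -/
def destOutput (net : DiamondNetwork N) (w : Inputs N × Noises N) : ℂ :=
  ∑ i, net.hd i * w.1.2 i + w.2.1

/-- The power constraint: `E |X_s|² ≤ P` and `E |X_i|² ≤ P` for every relay `i`. -/
def MeetsPower (net : DiamondNetwork N) (μ : ProbabilityMeasure (Inputs N)) : Prop :=
  ∫⁻ x, ‖x.1‖ₑ ^ 2 ∂(μ : Measure (Inputs N)) ≤ ENNReal.ofReal net.P ∧
    ∀ i, ∫⁻ x, ‖x.2 i‖ₑ ^ 2 ∂(μ : Measure (Inputs N)) ≤ ENNReal.ofReal net.P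

/-- The value `I(X_s, X_Λ; Y_d, Y_{Λᶜ} | X_{Λᶜ})` of the cut `Λ`, in bits, for inputs of law `μ`. -/
def cutValue (net : DiamondNetwork N) (μ : ProbabilityMeasure (Inputs N))
    (Λ : Finset (Fin N)) : ℝ≥0∞ :=
  condMutualInfo
    (fun w : Inputs N × Noises N => (w.1.1, fun i : {i // i ∈ Λ} => w.1.2 i))
    (fun w => (net.destOutput w, fun i : {i // i ∈ Λᶜ} => net.relayOutput i w))
    (fun w => fun i : {i // i ∈ Λᶜ} => w.1.2 i)
    (net.jointLaw μ) / ENNReal.ofReal (Real.log 2)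

/-- The cut-set bound: the supremum over all joint laws of the inputs that meet the power
constraint of the minimal cut value. -/
def cutSetBound (net : DiamondNetwork N) : ℝ≥0∞ :=
  ⨆ (μ : ProbabilityMeasure (Inputs N)) (_ : net.MeetsPower μ),
    ⨅ Λ : Finset (Fin N), net.cutValue μ Λ

/-- `R_{is} = log₂ (1 + SNR |h_{is}|²)`. -/
def Rs (net : DiamondNetwork N) (i : Fin N) : ℝ :=
  Real.logb 2 (1 + net.snr * ‖net.hs i‖ ^ 2)

/-- `R_{id} = log₂ (1 + SNR |h_{id}|²)`. -/
def Rd (net : DiamondNetwork N) (i : Fin N) : ℝ :=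
  Real.logb 2 (1 + net.snr * ‖net.hd i‖ ^ 2)

end DiamondNetwork

/-- The maximum of the (nonnegative) numbers `R i`, `i ∈ Λ`; it is `0` when `Λ` is empty. -/
def maxOver {N : ℕ} (Λ : Finset (Fin N)) (R : Fin N → ℝ) : ℝ :=
  if h : Λ.Nonempty then Λ.sup' h R else 0

/-- `ω = min_Λ (max_{i ∈ Λ} R_{id} + max_{i ∉ Λ} R_{is})`. -/
def DiamondNetwork.omega {N : ℕ} (net : DiamondNetwork N) : ℝ :=
  (Finset.univ : Finset (Finset (Fin N))).inf' Finset.univ_nonempty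
    (fun Λ => maxOver Λ net.Rd + maxOver Λᶜ net.Rs)

/-- The gap `G = max (3 log₂ N - log₂ (27 / 4), 2 log₂ N)`. -/
def beamformingGap (N : ℕ) : ℝ :=
  max (3 * Real.logb 2 N - Real.logb 2 (27 / 4)) (2 * Real.logb 2 N)

end

noncomputable section

/-! Fix a cut `Λ`. Once `X_{Λᶜ}` is known, its contribution to `Y_d` can be subtracted, which leaves
two Gaussian channels with independent noises and possibly dependent inputs: a scalar channel with
input `S = ∑_{i ∈ Λ} h_{id} X_i`, and a vector channel in which the relays of `Λᶜ` all observe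
`X_s`. Each depends on its output only through a matched filter of gain `G`. Compared with the
output of a `CN(0, p)` input, such a channel has divergence exactly `log (1 + pG/v) + G (E|s|² -
p)/(v + pG)` in nats (`IsGaussianChannel.klDiv_eq`). The chain rule adds the divergences of the two
channels (`klDiv_parallel`, `klDiv_cut`).

The bridge to conditional mutual information is the golden formula (`condMutualInfo_le_klDiv`):
`I(X; Y | Z)` is at most the divergence obtained by replacing the law of `Y` given `Z` by any
kernel, with equality for the true conditional law. No differential entropy is needed, and inputs
without densities are covered.

Upper bound: by Cauchy-Schwarz `E|S|² ≤ P (∑_{i ∈ Λ} |h_{id}|)²`, the value for fully correlated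
signals. Taking `p` equal to the moment bounds makes the correction terms nonpositive. With `k =
|Λ|`, comparing with the best branch costs at most `2 log₂ k` on the destination side and `log₂ (N -
k)` on the relay side. For `0 < k < N` the inequality `k² (N - k) ≤ 4N³/27` gives the first term of
`G`; the extreme cuts give `2 log₂ N`.

Lower bound: for independent Gaussian inputs of full power the comparison law is the true one for
every cut simultaneously, so the cut value is `log₂ (1 + SNR ∑_{Λ} |h_{id}|²) + log₂ (1 + SNR ∑_{Λᶜ}
|h_{is}|²)`, and each sum dominates its largest term. -/

/-! ### Circularly symmetric complex Gaussian laws -/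

theorem lintegral_complexGaussian (v : ℝ≥0) {f : ℂ → ℝ≥0∞} (hf : Measurable f) :
    ∫⁻ z, f z ∂complexGaussian v =
      ∫⁻ x, ∫⁻ y, f ⟨x, y⟩ ∂gaussianReal 0 (v / 2) ∂gaussianReal 0 (v / 2) := by
  rw [complexGaussian, lintegral_map hf Complex.measurableEquivRealProd.symm.measurable,
    lintegral_prod (fun a => f (Complex.measurableEquivRealProd.symm a))
      (hf.comp Complex.measurableEquivRealProd.symm.measurable).aemeasurable]
  rfl

theorem map_re_complexGaussian (v : ℝ≥0) :
    (complexGaussian v).map Complex.re = gaussianReal 0 (v / 2) := by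
  rw [complexGaussian, Measure.map_map Complex.measurable_re
    Complex.measurableEquivRealProd.symm.measurable]
  have : Complex.re ∘ Complex.measurableEquivRealProd.symm = Prod.fst := rfl
  rw [this, Measure.map_fst_prod, measure_univ, one_smul]

theorem map_im_complexGaussian (v : ℝ≥0) :
    (complexGaussian v).map Complex.im = gaussianReal 0 (v / 2) := by
  rw [complexGaussian, Measure.map_map Complex.measurable_im
    Complex.measurableEquivRealProd.symm.measurable]
  have : Complex.im ∘ Complex.measurableEquivRealProd.symm = Prod.snd := rfl
  rw [this, Measure.map_snd_prod, measure_univ, one_smul]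

theorem integrable_pow_gaussianReal (v : ℝ≥0) (n : ℕ) :
    Integrable (fun x : ℝ => x ^ n) (gaussianReal 0 v) := by
  have h : MemLp (id : ℝ → ℝ) n (gaussianReal 0 v) := memLp_id_gaussianReal n
  refine (integrable_norm_iff (by fun_prop)).1 ?_
  simpa [norm_pow] using h.integrable_norm_pow'

theorem integral_sq_gaussianReal (v : ℝ≥0) : ∫ x, x ^ 2 ∂gaussianReal 0 v = v := by
  have h := variance_fun_id_gaussianReal (μ := 0) (v := v)
  rwa [variance_of_integral_eq_zero (by fun_prop) (by simp)] at h

section Moments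

variable (v : ℝ≥0)

theorem integrable_re_complexGaussian : Integrable Complex.re (complexGaussian v) := by
  have h := integrable_pow_gaussianReal (v / 2) 1
  rw [← map_re_complexGaussian, integrable_map_measure (by fun_prop) (by fun_prop)] at h
  simpa [Function.comp_def] using h

theorem integrable_im_complexGaussian : Integrable Complex.im (complexGaussian v) := by
  have h := integrable_pow_gaussianReal (v / 2) 1
  rw [← map_im_complexGaussian, integrable_map_measure (by fun_prop) (by fun_prop)] at h
  simpa [Function.comp_def] using h

theorem integral_re_complexGaussian : ∫ z, z.re ∂complexGaussian v = 0 := by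
  have h := integral_id_gaussianReal (μ := 0) (v := v / 2)
  rwa [← map_re_complexGaussian, integral_map (by fun_prop) (by fun_prop)] at h

theorem integral_im_complexGaussian : ∫ z, z.im ∂complexGaussian v = 0 := by
  have h := integral_id_gaussianReal (μ := 0) (v := v / 2)
  rwa [← map_im_complexGaussian, integral_map (by fun_prop) (by fun_prop)] at h

theorem integrable_re_sq_complexGaussian :
    Integrable (fun z : ℂ => z.re ^ 2) (complexGaussian v) := by
  have h := integrable_pow_gaussianReal (v / 2) 2
  rw [← map_re_complexGaussian, integrable_map_measure (by fun_prop) (by fun_prop)] at h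
  exact h

theorem integrable_im_sq_complexGaussian :
    Integrable (fun z : ℂ => z.im ^ 2) (complexGaussian v) := by
  have h := integrable_pow_gaussianReal (v / 2) 2
  rw [← map_im_complexGaussian, integrable_map_measure (by fun_prop) (by fun_prop)] at h
  exact h

theorem norm_sq_eq_re_sq_add_im_sq (z : ℂ) : ‖z‖ ^ 2 = z.re ^ 2 + z.im ^ 2 := by
  rw [← Complex.normSq_eq_norm_sq, Complex.normSq_apply]; ring

theorem integrable_norm_sq_complexGaussian :
    Integrable (fun z : ℂ => ‖z‖ ^ 2) (complexGaussian v) := by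
  simp_rw [norm_sq_eq_re_sq_add_im_sq]
  exact (integrable_re_sq_complexGaussian v).add (integrable_im_sq_complexGaussian v)

theorem integral_norm_sq_complexGaussian : ∫ z, ‖z‖ ^ 2 ∂complexGaussian v = v := by
  simp_rw [norm_sq_eq_re_sq_add_im_sq]
  rw [integral_add (integrable_re_sq_complexGaussian v) (integrable_im_sq_complexGaussian v)]
  have h := integral_sq_gaussianReal (v / 2)
  have h' := h
  rw [← map_re_complexGaussian, integral_map (by fun_prop) (by fun_prop)] at h
  rw [← map_im_complexGaussian, integral_map (by fun_prop) (by fun_prop)] at h'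
  rw [h, h']; push_cast; ring

end Moments

/-- The value depends on `t` only through its norm, which is circular symmetry. The factor `1/4` is
the usual `1/2` times the variance `v / 2` of each real coordinate. -/
theorem charFun_complexGaussian (v : ℝ≥0) (t : ℂ) :
    charFun (complexGaussian v) t = Complex.exp (-(v * ‖t‖ ^ 2 / 4 : ℝ)) := by
  have hin (x y : ℝ) : inner ℝ (⟨x, y⟩ : ℂ) t = x * t.re + y * t.im := by
    rw [Complex.inner]; simp; ring
  have key (x : ℝ × ℝ) : Complex.exp
      (inner ℝ (Complex.measurableEquivRealProd.symm x) t * Complex.I) =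
      Complex.exp (t.re * x.1 * Complex.I) * Complex.exp (t.im * x.2 * Complex.I) := by
    rw [← Complex.exp_add]
    congr 1
    rw [show Complex.measurableEquivRealProd.symm x = (⟨x.1, x.2⟩ : ℂ) from rfl, hin]
    push_cast; ring
  rw [charFun_apply, complexGaussian,
    integral_map_equiv]
  simp_rw [key]
  rw [integral_prod_mul (fun x : ℝ => Complex.exp (t.re * x * Complex.I))
    (fun x : ℝ => Complex.exp (t.im * x * Complex.I)), ← charFun_apply_real, ← charFun_apply_real,
    charFun_gaussianReal, charFun_gaussianReal, ← Complex.exp_add, norm_sq_eq_re_sq_add_im_sq]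
  congr 1
  push_cast; ring

/-- A linear combination of i.i.d. circularly symmetric Gaussian variables is circularly symmetric
Gaussian. -/
theorem map_sum_mul_pi_complexGaussian {ι : Type*} [Fintype ι] (v : ℝ≥0) (c : ι → ℂ) :
    (Measure.pi fun _ : ι => complexGaussian v).map (fun x => ∑ i, c i * x i) =
      complexGaussian (v * ∑ i, ‖c i‖₊ ^ 2) := by
  refine Measure.ext_of_charFun ?_
  ext t
  -- Multiplication by `c i` is moved to its adjoint, multiplication by the conjugate, so that the
  -- characteristic function factors over the coordinates.
  have hin (x : ι → ℂ) : Complex.exp (inner ℝ (∑ i, c i * x i) t * Complex.I) =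
      ∏ i, Complex.exp (inner ℝ (x i) (starRingEnd ℂ (c i) * t) * Complex.I) := by
    rw [← Complex.exp_sum, ← Finset.sum_mul, sum_inner]
    congr 2
    push_cast
    refine Finset.sum_congr rfl fun i _ => ?_
    rw [Complex.inner, Complex.inner]
    congr 2
    simp; ring
  have hm : Measurable fun x : ι → ℂ => ∑ i, c i * x i :=
    Finset.measurable_sum _ fun i _ => Measurable.const_mul
      (f := fun x : ι → ℂ => x i) (measurable_pi_apply i) (c i)
  rw [charFun_apply, integral_map hm.aemeasurable (by fun_prop), charFun_complexGaussian]
  simp_rw [hin]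
  rw [integral_fintype_prod_eq_prod (fun i (x : ℂ) =>
    Complex.exp (inner ℝ x (starRingEnd ℂ (c i) * t) * Complex.I))]
  simp_rw [← charFun_apply, charFun_complexGaussian]
  rw [← Complex.exp_sum]
  congr 1
  push_cast
  rw [Finset.sum_neg_distrib, Finset.mul_sum, Finset.sum_mul, Finset.sum_div]
  congr 1
  refine Finset.sum_congr rfl fun i _ => ?_
  simp; ring

/-! ### Likelihood ratios of shifted Gaussians -/

/-- The likelihood ratio of a Gaussian vector shifted by `s • g` with respect to the unshifted one,
as a function of the matched filter output `w = ⟪g, y⟫`, with `G = ‖g‖²` and noise variance `v`. -/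
def shiftDensity (v G : ℝ) (s w : ℂ) : ℝ :=
  Real.exp ((2 * (s.re * w.re + s.im * w.im) - G * ‖s‖ ^ 2) / v)

theorem measurable_shiftDensity (v G : ℝ) :
    Measurable fun x : ℂ × ℂ => shiftDensity v G x.1 x.2 := by
  unfold shiftDensity; fun_prop

theorem gaussianReal_map_add_eq_withDensity {u : ℝ≥0} (hu : u ≠ 0) (m : ℝ) :
    (gaussianReal 0 u).map (m + ·) = (gaussianReal 0 u).withDensity
      fun x => ENNReal.ofReal (Real.exp ((2 * (m * x) - m ^ 2) / (2 * u))) := by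
  have hu' : (u : ℝ) ≠ 0 := by exact_mod_cast hu
  rw [gaussianReal_map_const_add, gaussianReal_of_var_ne_zero _ hu,
    gaussianReal_of_var_ne_zero _ hu,
    ← withDensity_mul _ (measurable_gaussianPDF _ _) (by fun_prop)]
  congr 1
  ext x
  rw [Pi.mul_apply, gaussianPDF, gaussianPDF, ← ENNReal.ofReal_mul (gaussianPDFReal_nonneg _ _ _),
    gaussianPDFReal, gaussianPDFReal, mul_assoc (√(2 * Real.pi * u))⁻¹, ← Real.exp_add]
  congr 3
  field_simp
  ring

theorem complexGaussian_map_add_eq_withDensity {v : ℝ≥0} (hv : v ≠ 0) (m : ℂ) :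
    (complexGaussian v).map (m + ·) = (complexGaussian v).withDensity
      fun y => ENNReal.ofReal (shiftDensity v 1 m y) := by
  have hu : v / 2 ≠ 0 := by simpa using hv
  have hv' : (v : ℝ) ≠ 0 := by exact_mod_cast hv
  have key (n : ℝ) (f : ℝ → ℝ≥0∞) (hf : Measurable f) :
      ∫⁻ x, f (n + x) ∂gaussianReal 0 (v / 2) = ∫⁻ x, ENNReal.ofReal
        (Real.exp ((2 * (n * x) - n ^ 2) / v)) * f x ∂gaussianReal 0 (v / 2) := by
    rw [← lintegral_map hf (by fun_prop), gaussianReal_map_add_eq_withDensity hu,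
      lintegral_withDensity_eq_lintegral_mul _ (by fun_prop) hf]
    refine lintegral_congr fun x => ?_
    simp only [Pi.mul_apply, NNReal.coe_div, NNReal.coe_ofNat]
    rw [mul_div_cancel₀ _ (two_ne_zero)]
  refine Measure.ext_of_lintegral _ fun f hf => ?_
  have hmk : Measurable fun p : ℝ × ℝ => (⟨p.1, p.2⟩ : ℂ) :=
    Complex.measurableEquivRealProd.symm.measurable
  have hd : Measurable fun y => ENNReal.ofReal (shiftDensity v 1 m y) :=
    ((measurable_shiftDensity v 1).comp (measurable_const.prodMk measurable_id)).ennreal_ofReal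
  rw [lintegral_map hf (by fun_prop), lintegral_withDensity_eq_lintegral_mul _ hd hf,
    lintegral_complexGaussian _ (f := fun a => f (m + a)) (hf.comp (by fun_prop)),
    lintegral_complexGaussian _ (hd.mul hf)]
  have hadd (x y : ℝ) : m + ⟨x, y⟩ = (⟨m.re + x, m.im + y⟩ : ℂ) := by
    apply Complex.ext <;> simp
  have hF : Measurable fun x : ℝ =>
      ∫⁻ y, f ⟨x, m.im + y⟩ ∂gaussianReal 0 (v / 2) :=
    Measurable.lintegral_prod_right' (f := fun p : ℝ × ℝ => f ⟨p.1, m.im + p.2⟩)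
      (hf.comp (hmk.comp (by fun_prop : Measurable fun p : ℝ × ℝ => (p.1, m.im + p.2))))
  simp_rw [hadd]
  rw [key m.re (fun x => ∫⁻ y, f ⟨x, m.im + y⟩ ∂gaussianReal 0 (v / 2)) hF]
  refine lintegral_congr fun x => ?_
  have hfx : Measurable fun y : ℝ => f ⟨x, y⟩ :=
    hf.comp (hmk.comp (by fun_prop : Measurable fun y : ℝ => (x, y)))
  rw [key m.im (fun y => f ⟨x, y⟩) hfx, ← lintegral_const_mul _ (by fun_prop)]
  refine lintegral_congr fun y => ?_
  rw [Pi.mul_apply, ← mul_assoc, ← ENNReal.ofReal_mul (Real.exp_nonneg _), ← Real.exp_add,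
    shiftDensity, norm_sq_eq_re_sq_add_im_sq]
  congr 4
  ring

/-- Completing the square: prior times likelihood is a constant, the evidence, times the Gaussian
posterior density of the input, which integrates to one. The degenerate prior `p = 0` is a point
mass and has no density. -/
theorem lintegral_exp_quadratic_gaussianReal {v : ℝ} (hv : 0 < v) (p : ℝ≥0) {G : ℝ} (hG : 0 ≤ G)
    (b : ℝ) :
    ∫⁻ x, ENNReal.ofReal (Real.exp ((2 * (x * b) - G * x ^ 2) / v)) ∂gaussianReal 0 (p / 2) =
      ENNReal.ofReal (√(v / (v + p * G)) * Real.exp (p / (v * (v + p * G)) * b ^ 2)) := by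
  rcases eq_or_ne p 0 with rfl | hp
  · simp [gaussianReal_zero_var, hv.ne']
  have hp' : (0 : ℝ) < p := by positivity
  have hD : 0 < v + p * G := by positivity
  have hu2 : p / 2 ≠ 0 := by simpa using hp
  -- The posterior variance, which goes with the posterior mean `p * b / (v + p * G)`.
  set u : ℝ≥0 := ⟨p * v / (2 * (v + p * G)), by positivity⟩ with hu
  have huc : (u : ℝ) = p * v / (2 * (v + p * G)) := rfl
  have hu0 : u ≠ 0 := by
    rw [ne_eq, ← NNReal.coe_eq_zero, huc]; positivity
  rw [gaussianReal_of_var_ne_zero _ hu2,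
    lintegral_withDensity_eq_lintegral_mul _ (measurable_gaussianPDF _ _) (by fun_prop)]
  have key (x : ℝ) : gaussianPDFReal 0 (p / 2) x * Real.exp ((2 * (x * b) - G * x ^ 2) / v) =
      (√(v / (v + p * G)) * Real.exp (p / (v * (v + p * G)) * b ^ 2)) *
        gaussianPDFReal (p * b / (v + p * G)) u x := by
    rw [gaussianPDFReal, gaussianPDFReal, mul_assoc, ← Real.exp_add,
      mul_mul_mul_comm, ← Real.exp_add, huc]
    congr 1
    · rw [← Real.sqrt_inv, ← Real.sqrt_inv, ← Real.sqrt_mul (by positivity)]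
      congr 1
      push_cast
      field_simp
    · congr 1
      push_cast
      field_simp
      ring
  have : ∀ x, (gaussianPDF 0 (p / 2) * fun x =>
      ENNReal.ofReal (Real.exp ((2 * (x * b) - G * x ^ 2) / v))) x =
      ENNReal.ofReal (√(v / (v + p * G)) * Real.exp (p / (v * (v + p * G)) * b ^ 2)) *
        gaussianPDF (p * b / (v + p * G)) u x := fun x => by
    rw [Pi.mul_apply, gaussianPDF, gaussianPDF,
      ← ENNReal.ofReal_mul (gaussianPDFReal_nonneg _ _ _), key, ENNReal.ofReal_mul (by positivity)]
  simp_rw [this]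
  rw [lintegral_const_mul _ (measurable_gaussianPDF _ _), lintegral_gaussianPDF_eq_one _ hu0,
    mul_one]

theorem lintegral_shiftDensity_complexGaussian {v : ℝ} (hv : 0 < v) (p : ℝ≥0) {G : ℝ}
    (hG : 0 ≤ G) (w : ℂ) :
    ∫⁻ s, ENNReal.ofReal (shiftDensity v G s w) ∂complexGaussian p =
      ENNReal.ofReal (v / (v + p * G) * Real.exp (p / (v * (v + p * G)) * ‖w‖ ^ 2)) := by
  have hD : 0 < v + p * G := by positivity
  have hd : Measurable fun s => ENNReal.ofReal (shiftDensity v G s w) :=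
    ((measurable_shiftDensity v G).comp (measurable_id.prodMk measurable_const)).ennreal_ofReal
  rw [lintegral_complexGaussian _ hd]
  have key (x y : ℝ) : ENNReal.ofReal (shiftDensity v G ⟨x, y⟩ w) =
      ENNReal.ofReal (Real.exp ((2 * (x * w.re) - G * x ^ 2) / v)) *
        ENNReal.ofReal (Real.exp ((2 * (y * w.im) - G * y ^ 2) / v)) := by
    rw [← ENNReal.ofReal_mul (Real.exp_nonneg _), ← Real.exp_add, shiftDensity,
      norm_sq_eq_re_sq_add_im_sq]
    congr 2
    ring
  simp_rw [key]
  simp_rw [lintegral_const_mul _ (by fun_prop : Measurable fun y : ℝ =>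
    ENNReal.ofReal (Real.exp ((2 * (y * w.im) - G * y ^ 2) / v)))]
  rw [lintegral_mul_const _ (by fun_prop), lintegral_exp_quadratic_gaussianReal hv p hG,
    lintegral_exp_quadratic_gaussianReal hv p hG, ← ENNReal.ofReal_mul (by positivity),
    mul_mul_mul_comm, ← Real.exp_add, Real.mul_self_sqrt (by positivity),
    norm_sq_eq_re_sq_add_im_sq, ← mul_add]

/-- A product of measures with densities has the product density. -/
theorem pi_withDensity {ι α : Type*} [Fintype ι] [MeasurableSpace α] (ν : Measure α)
    [IsProbabilityMeasure ν] {f : ι → α → ℝ≥0∞} (hf : ∀ i, Measurable (f i))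
    [∀ i, SigmaFinite (ν.withDensity (f i))] :
    (Measure.pi fun i => ν.withDensity (f i)) =
      (Measure.pi fun _ : ι => ν).withDensity fun x => ∏ i, f i (x i) := by
  classical
  refine Measure.pi_eq fun s hs => ?_
  have hind (i : ι) : Measurable ((s i).indicator (f i)) := (hf i).indicator (hs i)
  rw [withDensity_apply _ (MeasurableSet.univ_pi hs), ← lintegral_indicator
    (MeasurableSet.univ_pi hs)]
  -- With the box absorbed into the factors, the integrand is a product of functions of independent
  -- coordinates.
  have : ((Set.univ.pi s).indicator fun x : ι → α => ∏ i, f i (x i)) =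
      fun x => ∏ i, (s i).indicator (f i) (x i) := by
    ext x
    by_cases hx : x ∈ Set.univ.pi s
    · rw [Set.indicator_of_mem hx]
      exact Finset.prod_congr rfl fun i _ => (Set.indicator_of_mem (hx i trivial) _).symm
    · rw [Set.indicator_of_notMem hx]
      simp only [Set.mem_pi, Set.mem_univ, true_implies, not_forall] at hx
      obtain ⟨i, hi⟩ := hx
      exact (Finset.prod_eq_zero (Finset.mem_univ i) (Set.indicator_of_notMem hi _)).symm
  rw [this, lintegral_prod_eq_prod_lintegral_of_indepFun Finset.univ
    (fun i (x : ι → α) => (s i).indicator (f i) (x i))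
    (iIndepFun_pi (X := fun i => (s i).indicator (f i)) fun i => (hind i).aemeasurable)
    fun i => (hind i).comp (measurable_pi_apply i)]
  refine Finset.prod_congr rfl fun i _ => ?_
  rw [← lintegral_map (hind i) (measurable_pi_apply i), Measure.pi_map_eval,
    lintegral_smul_measure, withDensity_apply _ (hs i), lintegral_indicator (hs i)]
  simp

/-! ### Gaussian channels and their divergence from a Gaussian output law -/

/-- A Gaussian channel with scalar input `s`: the output is `shift s n`, where the noise `n` has law
`ν`, and `φ` is the matched filter, a sufficient statistic whose value is `G s` plus noise
`CN(0, v G)`. -/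
structure IsGaussianChannel {E : Type*} [MeasurableSpace E] (ν : Measure E) (shift : ℂ → E → E)
    (φ : E → ℂ) (v G : ℝ≥0) : Prop where
  v_pos : 0 < v
  measurable_shift : Measurable fun x : ℂ × E => shift x.1 x.2
  measurable_filter : Measurable φ
  filter_shift : ∀ s n, φ (shift s n) = G * s + φ n
  map_shift : ∀ s, ν.map (shift s) =
    ν.withDensity fun y => ENNReal.ofReal (shiftDensity v G s (φ y))
  map_filter : ν.map φ = complexGaussian (v * G)

/-- The law of the output of a channel whose input has law `CN(0, p)`. -/
def gaussianOutput {E : Type*} [MeasurableSpace E] (ν : Measure E) (shift : ℂ → E → E) (p : ℝ≥0) :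
    Measure E :=
  ((complexGaussian p).prod ν).map fun x => shift x.1 x.2

namespace IsGaussianChannel

variable {E : Type*} [MeasurableSpace E] {ν : Measure E} {shift : ℂ → E → E} {φ : E → ℂ}
  {v G : ℝ≥0}

theorem isProbabilityMeasure_gaussianOutput [IsProbabilityMeasure ν]
    (h : IsGaussianChannel ν shift φ v G) (p : ℝ≥0) :
    IsProbabilityMeasure (gaussianOutput ν shift p) :=
  Measure.isProbabilityMeasure_map h.measurable_shift.aemeasurable

theorem measurable_shift_left (h : IsGaussianChannel ν shift φ v G) (s : ℂ) :
    Measurable (shift s) :=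
  h.measurable_shift.comp measurable_prodMk_left

theorem lintegral_shift (h : IsGaussianChannel ν shift φ v G) (s : ℂ) {f : E → ℝ≥0∞}
    (hf : Measurable f) :
    ∫⁻ n, f (shift s n) ∂ν = ∫⁻ y, ENNReal.ofReal (shiftDensity v G s (φ y)) * f y ∂ν := by
  have hd : Measurable fun y => ENNReal.ofReal (shiftDensity v G s (φ y)) :=
    ((measurable_shiftDensity v G).comp
      (measurable_const.prodMk h.measurable_filter)).ennreal_ofReal
  rw [← lintegral_map hf (h.measurable_shift_left s), h.map_shift,
    lintegral_withDensity_eq_lintegral_mul _ hd hf]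
  simp only [Pi.mul_apply]

/-- The density of the output law of a Gaussian input, as a function of the matched filter. -/
def outputDensity (v G p : ℝ≥0) (w : ℂ) : ℝ :=
  v / (v + p * G) * Real.exp (p / (v * (v + p * G)) * ‖w‖ ^ 2)

theorem measurable_outputDensity (v G p : ℝ≥0) : Measurable (outputDensity v G p) := by
  unfold outputDensity; fun_prop

/-- By Tonelli, the density of the mixture is the likelihood ratio averaged over the Gaussian input.
The noise law `ν` thus serves as common reference measure for all output laws. -/
theorem gaussianOutput_eq_withDensity [IsProbabilityMeasure ν]
    (h : IsGaussianChannel ν shift φ v G) (p : ℝ≥0) :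
    gaussianOutput ν shift p =
      ν.withDensity fun y => ENNReal.ofReal (outputDensity v G p (φ y)) := by
  have hv : (0 : ℝ) < v := h.v_pos
  have hq : Measurable fun y => ENNReal.ofReal (outputDensity v G p (φ y)) :=
    ((measurable_outputDensity v G p).comp h.measurable_filter).ennreal_ofReal
  have hd : Measurable fun x : ℂ × E => ENNReal.ofReal (shiftDensity v G x.1 (φ x.2)) :=
    ((measurable_shiftDensity v G).comp
      (measurable_fst.prodMk (h.measurable_filter.comp measurable_snd))).ennreal_ofReal
  refine Measure.ext_of_lintegral _ fun f hf => ?_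
  rw [gaussianOutput, lintegral_map hf h.measurable_shift,
    lintegral_prod (fun x : ℂ × E => f (shift x.1 x.2)) (hf.comp h.measurable_shift).aemeasurable,
    lintegral_withDensity_eq_lintegral_mul _ hq hf]
  simp_rw [h.lintegral_shift _ hf]
  rw [lintegral_lintegral_swap (f := fun s y => ENNReal.ofReal (shiftDensity v G s (φ y)) * f y)
    (hd.mul (hf.comp measurable_snd)).aemeasurable]
  refine lintegral_congr fun y => ?_
  have hs : Measurable fun s => ENNReal.ofReal (shiftDensity v G s (φ y)) :=
    ((measurable_shiftDensity v G).comp (measurable_id.prodMk measurable_const)).ennreal_ofReal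
  have he := lintegral_shiftDensity_complexGaussian hv p G.coe_nonneg (φ y)
  rw [lintegral_mul_const (f y) hs, he, Pi.mul_apply, outputDensity]

/-- The joint law of a channel's input data and its output, with density with respect to the
product of the input law and the noise law. -/
theorem map_prod_shift_eq_withDensity [IsProbabilityMeasure ν]
    (h : IsGaussianChannel ν shift φ v G) {T : Type*} [MeasurableSpace T] (τ : Measure T)
    [IsProbabilityMeasure τ] {s : T → ℂ} (hs : Measurable s) :
    (τ.prod ν).map (fun x => (x.1, shift (s x.1) x.2)) =
      (τ.prod ν).withDensity fun x => ENNReal.ofReal (shiftDensity v G (s x.1) (φ x.2)) := by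
  have hd : Measurable fun x : T × E => ENNReal.ofReal (shiftDensity v G (s x.1) (φ x.2)) :=
    ((measurable_shiftDensity v G).comp ((hs.comp measurable_fst).prodMk
      (h.measurable_filter.comp measurable_snd))).ennreal_ofReal
  have hm : Measurable fun x : T × E => (x.1, shift (s x.1) x.2) :=
    measurable_fst.prodMk
      (h.measurable_shift.comp ((hs.comp measurable_fst).prodMk measurable_snd))
  refine Measure.ext_of_lintegral _ fun f hf => ?_
  rw [lintegral_map hf hm, lintegral_prod (fun x => f (x.1, shift (s x.1) x.2))
    (hf.comp hm).aemeasurable, lintegral_withDensity_eq_lintegral_mul _ hd hf,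
    lintegral_prod _ (hd.mul hf).aemeasurable]
  exact lintegral_congr fun t => h.lintegral_shift (s t) (hf.comp measurable_prodMk_left)

/-- The logarithm of the ratio of the densities of a channel's output given its input and of
the output of a Gaussian input. -/
def logRatio (v G p : ℝ≥0) (s w : ℂ) : ℝ :=
  (2 * (s.re * w.re + s.im * w.im) - G * ‖s‖ ^ 2) / v - p / (v * (v + p * G)) * ‖w‖ ^ 2 +
    Real.log (1 + p * G / v)

theorem log_shiftDensity_div_outputDensity {v : ℝ≥0} (hv : 0 < v) (G p : ℝ≥0) (s w : ℂ) :
    Real.log (shiftDensity v G s w / outputDensity v G p w) = logRatio v G p s w := by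
  have hv' : (0 : ℝ) < v := hv
  have hD : (0 : ℝ) < v + p * G := by positivity
  rw [shiftDensity, outputDensity, Real.log_div (Real.exp_ne_zero _) (by positivity),
    Real.log_mul (by positivity) (Real.exp_ne_zero _), Real.log_exp, Real.log_exp, logRatio,
    show 1 + (p : ℝ) * G / v = ((v : ℝ) / (v + p * G))⁻¹ by field_simp, Real.log_inv]
  ring

theorem integral_filter [IsProbabilityMeasure ν] (h : IsGaussianChannel ν shift φ v G) :
    Integrable (fun n => (φ n).re) ν ∧ Integrable (fun n => (φ n).im) ν ∧
    Integrable (fun n => ‖φ n‖ ^ 2) ν ∧ ∫ n, (φ n).re ∂ν = 0 ∧ ∫ n, (φ n).im ∂ν = 0 ∧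
    ∫ n, ‖φ n‖ ^ 2 ∂ν = v * G := by
  have hφ := h.measurable_filter
  have h1 := integrable_re_complexGaussian (v * G)
  have h2 := integrable_im_complexGaussian (v * G)
  have h3 := integrable_norm_sq_complexGaussian (v * G)
  have h4 := integral_re_complexGaussian (v * G)
  have h5 := integral_im_complexGaussian (v * G)
  have h6 := integral_norm_sq_complexGaussian (v * G)
  rw [← h.map_filter] at h1 h2 h3 h4 h5 h6
  rw [integrable_map_measure (by fun_prop) hφ.aemeasurable] at h1 h2 h3
  rw [integral_map hφ.aemeasurable (by fun_prop)] at h4 h5 h6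
  exact ⟨h1, h2, h3, h4, h5, by simpa using h6⟩

/-- Substituting `G * s + φ n` for the filter output makes the log ratio quadratic in `s` and `φ n`.
The cross terms vanish because the noise is centred and independent of the input, so only `E|s|²`
and `E|φ n|² = v G` remain. -/
theorem integral_logRatio [IsProbabilityMeasure ν] (h : IsGaussianChannel ν shift φ v G)
    {T : Type*} [MeasurableSpace T] (τ : Measure T) [IsProbabilityMeasure τ] {s : T → ℂ}
    (hs : Measurable s) (hs2 : Integrable (fun t => ‖s t‖ ^ 2) τ) (p : ℝ≥0) :
    Integrable (fun x : T × E => logRatio v G p (s x.1) (φ (shift (s x.1) x.2))) (τ.prod ν) ∧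
    ∫ x : T × E, logRatio v G p (s x.1) (φ (shift (s x.1) x.2)) ∂(τ.prod ν) =
      Real.log (1 + p * G / v) + G * (∫ t, ‖s t‖ ^ 2 ∂τ - p) / (v + p * G) := by
  have hv : (0 : ℝ) < v := h.v_pos
  have hD : (0 : ℝ) < v + p * G := by positivity
  obtain ⟨h1, h2, h3, h4, h5, h6⟩ := h.integral_filter
  have hm : MemLp s 2 τ := (memLp_two_iff_integrable_sq_norm hs.aestronglyMeasurable).2 hs2
  have hre : Integrable (fun t => (s t).re) τ := (hm.integrable one_le_two).re
  have him : Integrable (fun t => (s t).im) τ := (hm.integrable one_le_two).im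
  have i1 := hre.mul_prod h1
  have i2 := him.mul_prod h2
  have i3 := hs2.comp_fst ν
  have i4 := h3.comp_snd τ
  have e1 := integral_prod_mul (μ := τ) (ν := ν) (fun t => (s t).re) (fun n => (φ n).re)
  have e2 := integral_prod_mul (μ := τ) (ν := ν) (fun t => (s t).im) (fun n => (φ n).im)
  have e3 := integral_fun_fst (μ := τ) (ν := ν) (fun t => ‖s t‖ ^ 2)
  have e4 := integral_fun_snd (μ := τ) (ν := ν) (fun n => ‖φ n‖ ^ 2)
  rw [h4, mul_zero] at e1
  rw [h5, mul_zero] at e2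
  simp only [probReal_univ, one_smul, h6] at e3 e4
  set a : ℝ := p / (v * (v + p * G)) with ha
  have key (x : T × E) : logRatio v G p (s x.1) (φ (shift (s x.1) x.2)) =
      (2 / v - 2 * a * G) * ((s x.1).re * (φ x.2).re) +
      (2 / v - 2 * a * G) * ((s x.1).im * (φ x.2).im) +
      (G / v - a * G ^ 2) * ‖s x.1‖ ^ 2 + -a * ‖φ x.2‖ ^ 2 + Real.log (1 + p * G / v) := by
    rw [logRatio, h.filter_shift, ← ha]
    simp only [norm_sq_eq_re_sq_add_im_sq, Complex.add_re, Complex.add_im, Complex.mul_re,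
      Complex.mul_im]
    simp
    field_simp
    ring
  simp_rw [key]
  have j1 := i1.const_mul (2 / v - 2 * a * G)
  have j2 := i2.const_mul (2 / v - 2 * a * G)
  have j3 := i3.const_mul (G / v - a * G ^ 2)
  have j4 := i4.const_mul (-a)
  refine ⟨(((j1.add j2).add j3).add j4).add (integrable_const _), ?_⟩
  refine (integral_add (((j1.add j2).add j3).add j4) (integrable_const _)).trans ?_
  rw [integral_add' ((j1.add j2).add j3) j4, integral_add' (j1.add j2) j3, integral_add' j1 j2,
    integral_const_mul, integral_const_mul, integral_const_mul, integral_const_mul, e1, e2, e3, e4]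
  simp only [integral_const, probReal_univ, one_smul, ha]
  field_simp
  ring

/-- The divergence between the joint law of a channel's input data and output, and the law
under which the output is independent of the input and has the law of the output of a Gaussian
input of power `p`. -/
theorem klDiv_eq [IsProbabilityMeasure ν] (h : IsGaussianChannel ν shift φ v G)
    {T : Type*} [MeasurableSpace T] (τ : Measure T) [IsProbabilityMeasure τ] {s : T → ℂ}
    (hs : Measurable s) (hs2 : Integrable (fun t => ‖s t‖ ^ 2) τ) (p : ℝ≥0) :
    klDiv ((τ.prod ν).map fun x => (x.1, shift (s x.1) x.2))
      (τ.prod (gaussianOutput ν shift p)) =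
      ENNReal.ofReal
        (Real.log (1 + p * G / v) + G * (∫ t, ‖s t‖ ^ 2 ∂τ - p) / (v + p * G)) := by
  have hv : (0 : ℝ) < v := h.v_pos
  have hqpos (w : ℂ) : 0 < outputDensity v G p w := by unfold outputDensity; positivity
  have hφ := h.measurable_filter
  have hm : Measurable fun x : T × E => (x.1, shift (s x.1) x.2) :=
    measurable_fst.prodMk
      (h.measurable_shift.comp ((hs.comp measurable_fst).prodMk measurable_snd))
  have := h.isProbabilityMeasure_gaussianOutput p
  have : IsProbabilityMeasure ((τ.prod ν).map fun x => (x.1, shift (s x.1) x.2)) :=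
    Measure.isProbabilityMeasure_map hm.aemeasurable
  set r : T × E → ℝ := fun x =>
    shiftDensity v G (s x.1) (φ x.2) / outputDensity v G p (φ x.2) with hr
  have hqm : Measurable fun x : T × E => outputDensity v G p (φ x.2) :=
    (measurable_outputDensity v G p).comp (hφ.comp measurable_snd)
  have hrm : Measurable r := ((measurable_shiftDensity v G).comp
    ((hs.comp measurable_fst).prodMk (hφ.comp measurable_snd))).div hqm
  have hrpos (x) : 0 < r x := div_pos (Real.exp_pos _) (hqpos _)
  have hsig : SigmaFinite (ν.withDensity fun y => ENNReal.ofReal (outputDensity v G p (φ y))) := by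
    rw [← h.gaussianOutput_eq_withDensity p]; infer_instance
  have hR : τ.prod (gaussianOutput ν shift p) =
      (τ.prod ν).withDensity fun x => ENNReal.ofReal (outputDensity v G p (φ x.2)) := by
    rw [h.gaussianOutput_eq_withDensity p, prod_withDensity_right
      (g := fun y => ENNReal.ofReal (outputDensity v G p (φ y)))
      ((measurable_outputDensity v G p).comp hφ).ennreal_ofReal]
  -- Both laws have densities with respect to `τ.prod ν`, and the second density is positive, so
  -- their quotient is the relative density.
  have hP : ((τ.prod ν).map fun x => (x.1, shift (s x.1) x.2)) =
      (τ.prod (gaussianOutput ν shift p)).withDensity fun x => ENNReal.ofReal (r x) := by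
    rw [hR, ← withDensity_mul _ hqm.ennreal_ofReal hrm.ennreal_ofReal,
      h.map_prod_shift_eq_withDensity τ hs]
    congr 1
    ext x
    rw [Pi.mul_apply, ← ENNReal.ofReal_mul (hqpos _).le, hr]
    simp only
    rw [mul_div_cancel₀ _ (hqpos _).ne']
  set P := (τ.prod ν).map fun x => (x.1, shift (s x.1) x.2) with hPdef
  set R := τ.prod (gaussianOutput ν shift p)
  have hac : P ≪ R := hP ▸ withDensity_absolutelyContinuous _ _
  have hllr : llr P R =ᵐ[P] fun x => logRatio v G p (s x.1) (φ x.2) := by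
    have h0 : P.rnDeriv R =ᵐ[R] fun x => ENNReal.ofReal (r x) := by
      conv_lhs => rw [hP]
      exact Measure.rnDeriv_withDensity R hrm.ennreal_ofReal
    filter_upwards [hac.ae_eq h0] with x hx
    rw [llr, hx, ENNReal.toReal_ofReal (hrpos x).le,
      log_shiftDensity_div_outputDensity h.v_pos]
  obtain ⟨hi, he⟩ := h.integral_logRatio τ hs hs2 p
  have hlm : Measurable fun x : T × E => logRatio v G p (s x.1) (φ x.2) := by
    unfold logRatio; fun_prop
  have hint : Integrable (llr P R) P := by
    rw [integrable_congr hllr, hPdef, integrable_map_measure hlm.aestronglyMeasurable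
      hm.aemeasurable]
    exact hi
  rw [klDiv_of_ac_of_integrable hac hint, integral_congr_ae hllr, hPdef,
    integral_map hm.aemeasurable hlm.aestronglyMeasurable, he]
  -- The total mass terms in `klDiv` cancel, since both laws are probability measures.
  simp

end IsGaussianChannel

/-! ### Kernels from independent randomness, and parallel channels -/

/-- Data processing, applied to `e` and to its inverse. -/
theorem klDiv_map_measurableEquiv {α β : Type*} [MeasurableSpace α] [MeasurableSpace β]
    (μ ν : Measure α) [IsFiniteMeasure μ] [IsFiniteMeasure ν] (e : α ≃ᵐ β) :
    klDiv (μ.map e) (ν.map e) = klDiv μ ν := by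
  refine le_antisymm (klDiv_map_le μ ν e.measurable) ?_
  have h := klDiv_map_le (μ.map e) (ν.map e) e.symm.measurable
  rwa [Measure.map_map e.symm.measurable e.measurable, Measure.map_map e.symm.measurable
    e.measurable, e.symm_comp_self, Measure.map_id, Measure.map_id] at h

section ParamKernel

variable {α β γ : Type*} [MeasurableSpace α] [MeasurableSpace β] [MeasurableSpace γ]

/-- The Markov kernel that sends `a` to the law of `f (a, b)`, where `b` has law `m`. -/
def paramKernel (m : Measure β) (f : α × β → γ) : Kernel α γ :=
  ((Kernel.id : Kernel α α) ×ₖ Kernel.const α m).map f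

theorem isMarkovKernel_paramKernel (m : Measure β) [IsProbabilityMeasure m] {f : α × β → γ}
    (hf : Measurable f) : IsMarkovKernel (paramKernel m f) :=
  Kernel.IsMarkovKernel.map _ hf

theorem lintegral_paramKernel (m : Measure β) [IsProbabilityMeasure m] {f : α × β → γ}
    (hf : Measurable f) (a : α) {g : γ → ℝ≥0∞} (hg : Measurable g) :
    ∫⁻ c, g c ∂paramKernel m f a = ∫⁻ b, g (f (a, b)) ∂m := by
  have h : Measurable fun x : α × β => g (f x) := hg.comp hf
  rw [paramKernel, Kernel.lintegral_map _ hf _ hg, Kernel.lintegral_prod _ _ _ h,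
    Kernel.lintegral_id' h.lintegral_prod_right']
  simp only [Kernel.const_apply]

theorem map_prod_eq_compProd_paramKernel (τ : Measure α) [SFinite τ] (m : Measure β)
    [IsProbabilityMeasure m] {f : α × β → γ} (hf : Measurable f) :
    (τ.prod m).map (fun x => (x.1, f x)) = τ ⊗ₘ paramKernel m f := by
  have := isMarkovKernel_paramKernel m hf
  have hm : Measurable fun x : α × β => (x.1, f x) := measurable_fst.prodMk hf
  refine Measure.ext_of_lintegral _ fun g hg => ?_
  rw [lintegral_map hg hm, lintegral_prod (fun x => g (x.1, f x)) (hg.comp hm).aemeasurable,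
    Measure.lintegral_compProd hg]
  exact lintegral_congr fun a =>
    (lintegral_paramKernel m hf a (hg.comp measurable_prodMk_left)).symm

end ParamKernel

/-- The divergence for two independent Gaussian channels in parallel, with dependent inputs. -/
theorem IsGaussianChannel.klDiv_parallel {E₁ E₂ : Type*} [MeasurableSpace E₁] [MeasurableSpace E₂]
    {ν₁ : Measure E₁} {ν₂ : Measure E₂} [IsProbabilityMeasure ν₁] [IsProbabilityMeasure ν₂]
    {shift₁ : ℂ → E₁ → E₁} {shift₂ : ℂ → E₂ → E₂} {φ₁ : E₁ → ℂ} {φ₂ : E₂ → ℂ} {v G₁ G₂ : ℝ≥0}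
    (h₁ : IsGaussianChannel ν₁ shift₁ φ₁ v G₁) (h₂ : IsGaussianChannel ν₂ shift₂ φ₂ v G₂)
    {T : Type*} [MeasurableSpace T] (τ : Measure T) [IsProbabilityMeasure τ] {s₁ s₂ : T → ℂ}
    (hs₁ : Measurable s₁) (hs₂ : Measurable s₂) (hi₁ : Integrable (fun t => ‖s₁ t‖ ^ 2) τ)
    (hi₂ : Integrable (fun t => ‖s₂ t‖ ^ 2) τ) (p₁ p₂ : ℝ≥0) :
    klDiv ((τ.prod (ν₁.prod ν₂)).map
        fun x => (x.1, (shift₁ (s₁ x.1) x.2.1, shift₂ (s₂ x.1) x.2.2)))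
      (τ.prod ((gaussianOutput ν₁ shift₁ p₁).prod (gaussianOutput ν₂ shift₂ p₂))) =
      ENNReal.ofReal
        (Real.log (1 + p₁ * G₁ / v) + G₁ * (∫ t, ‖s₁ t‖ ^ 2 ∂τ - p₁) / (v + p₁ * G₁)) +
      ENNReal.ofReal
        (Real.log (1 + p₂ * G₂ / v) + G₂ * (∫ t, ‖s₂ t‖ ^ 2 ∂τ - p₂) / (v + p₂ * G₂)) := by
  have := h₁.isProbabilityMeasure_gaussianOutput p₁
  have := h₂.isProbabilityMeasure_gaussianOutput p₂
  have hm₁ : Measurable fun x : T × E₁ => shift₁ (s₁ x.1) x.2 :=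
    h₁.measurable_shift.comp ((hs₁.comp measurable_fst).prodMk measurable_snd)
  have hm₂ : Measurable fun x : T × E₂ => shift₂ (s₂ x.1) x.2 :=
    h₂.measurable_shift.comp ((hs₂.comp measurable_fst).prodMk measurable_snd)
  have hm₃ : Measurable fun x : (T × E₁) × E₂ => shift₂ (s₂ x.1.1) x.2 :=
    hm₂.comp (measurable_fst.fst.prodMk measurable_snd)
  have hm₁' : Measurable fun x : T × E₁ => (x.1, shift₁ (s₁ x.1) x.2) := measurable_fst.prodMk hm₁
  have hm₄ : Measurable fun x : T × E₁ × E₂ =>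
      (x.1, (shift₁ (s₁ x.1) x.2.1, shift₂ (s₂ x.1) x.2.2)) :=
    measurable_fst.prodMk ((hm₁.comp (measurable_fst.prodMk measurable_snd.fst)).prodMk
      (hm₂.comp (measurable_fst.prodMk measurable_snd.snd)))
  set e : T × E₁ × E₂ ≃ᵐ (T × E₁) × E₂ := MeasurableEquiv.prodAssoc.symm with he
  have hP₁ : IsProbabilityMeasure ((τ.prod ν₁).map fun x => (x.1, shift₁ (s₁ x.1) x.2)) :=
    Measure.isProbabilityMeasure_map hm₁'.aemeasurable
  have hP : IsProbabilityMeasure ((τ.prod (ν₁.prod ν₂)).map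
      fun x => (x.1, (shift₁ (s₁ x.1) x.2.1, shift₂ (s₂ x.1) x.2.2))) :=
    Measure.isProbabilityMeasure_map hm₄.aemeasurable
  set P₁ := (τ.prod ν₁).map fun x => (x.1, shift₁ (s₁ x.1) x.2) with hP₁def
  have hR : (τ.prod ((gaussianOutput ν₁ shift₁ p₁).prod (gaussianOutput ν₂ shift₂ p₂))).map e =
      (τ.prod (gaussianOutput ν₁ shift₁ p₁)) ⊗ₘ Kernel.const _ (gaussianOutput ν₂ shift₂ p₂) := by
    rw [Measure.compProd_const, ← Measure.prodAssoc_prod, Measure.map_map e.measurable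
      (MeasurableEquiv.measurable _), he, MeasurableEquiv.symm_comp_self, Measure.map_id]
  have hL : ((τ.prod (ν₁.prod ν₂)).map
        fun x => (x.1, (shift₁ (s₁ x.1) x.2.1, shift₂ (s₂ x.1) x.2.2))).map e =
      (P₁.prod ν₂).map (fun x => (x.1, shift₂ (s₂ x.1.1) x.2)) := by
    rw [← Measure.prodAssoc_prod, Measure.map_map hm₄ (MeasurableEquiv.measurable _),
      Measure.map_map e.measurable (hm₄.comp (MeasurableEquiv.measurable _)),
      ← Measure.map_id (μ := ν₂), hP₁def, Measure.map_prod_map _ _ hm₁' measurable_id,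
      Measure.map_id, Measure.map_map (measurable_fst.prodMk hm₃)
        (hm₁'.prodMap measurable_id)]
    rfl
  have := isMarkovKernel_paramKernel ν₂ hm₃
  -- Chain rule. The second input is a function of the data in `T` and the second noise is
  -- independent of the first channel, so the pair (data, first output) can be taken as the data of
  -- the second channel.
  rw [← klDiv_map_measurableEquiv _ _ e, hR, hL, map_prod_eq_compProd_paramKernel _ _ hm₃,
    klDiv_compProd_eq_add, ← map_prod_eq_compProd_paramKernel _ _ hm₃, Measure.compProd_const,
    hP₁def, h₁.klDiv_eq τ hs₁ hi₁]
  have hsq : Measurable fun x : T × E₁ => ‖s₂ x.1‖ ^ 2 :=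
    (hs₂.comp measurable_fst).norm.pow_const 2
  have hi₂' : Integrable (fun x : T × E₁ => ‖s₂ x.1‖ ^ 2) P₁ := by
    rw [hP₁def, integrable_map_measure hsq.aestronglyMeasurable
      hm₁'.aemeasurable]
    exact hi₂.comp_fst ν₁
  have hint : ∫ x, ‖s₂ x.1‖ ^ 2 ∂P₁ = ∫ t, ‖s₂ t‖ ^ 2 ∂τ := by
    rw [hP₁def, integral_map hm₁'.aemeasurable hsq.aestronglyMeasurable]
    have := integral_fun_fst (μ := τ) (ν := ν₁) (fun t => ‖s₂ t‖ ^ 2)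
    simpa using this
  congr 1
  have := h₂.klDiv_eq P₁ (s := fun x => s₂ x.1) (hs₂.comp measurable_fst) hi₂' p₂
  rw [hint] at this
  exact this

/-! ### Conditional mutual information and the golden formula -/

section Rearrange

variable {α β γ : Type*} [MeasurableSpace α] [MeasurableSpace β] [MeasurableSpace γ]

theorem lintegral_compProd_prod (m : Measure γ) [SFinite m] (A : Kernel γ α) [IsSFiniteKernel A]
    (B : Kernel γ β) [IsSFiniteKernel B] {f : γ × α × β → ℝ≥0∞} (hf : Measurable f) :
    ∫⁻ x, f x ∂(m ⊗ₘ (A ×ₖ B)) = ∫⁻ z, ∫⁻ a, ∫⁻ b, f (z, a, b) ∂B z ∂A z ∂m := by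
  rw [Measure.lintegral_compProd hf]
  refine lintegral_congr fun z => ?_
  have h : Measurable fun x : α × β => f (z, x) := hf.comp measurable_prodMk_left
  rw [Kernel.lintegral_prod _ _ _ h]

/-- The rearrangement `(z, (a, b)) ↦ ((z, b), a)`. -/
def rearrange (γ α β : Type*) [MeasurableSpace α] [MeasurableSpace β] [MeasurableSpace γ] :
    γ × α × β ≃ᵐ (γ × β) × α where
  toFun x := ((x.1, x.2.2), x.2.1)
  invFun x := (x.1.1, x.2, x.1.2)
  left_inv _ := rfl
  right_inv _ := rfl
  measurable_toFun := by
    simp only [Equiv.coe_fn_mk]; fun_prop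
  measurable_invFun := by
    simp only [Equiv.coe_fn_symm_mk]; fun_prop

theorem map_rearrange_compProd_prod (m : Measure γ) [SFinite m] (A : Kernel γ α)
    [IsSFiniteKernel A] (B : Kernel γ β) [IsSFiniteKernel B] :
    (m ⊗ₘ (A ×ₖ B)).map (rearrange γ α β) = (m ⊗ₘ B) ⊗ₘ (A.comap Prod.fst measurable_fst) := by
  refine Measure.ext_of_lintegral _ fun f hf => ?_
  rw [lintegral_map hf (rearrange γ α β).measurable,
    lintegral_compProd_prod (f := fun x => f (rearrange γ α β x)) _ _ _
      (hf.comp (rearrange γ α β).measurable),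
    Measure.lintegral_compProd hf, Measure.lintegral_compProd hf.lintegral_kernel_prod_right']
  refine lintegral_congr fun z => ?_
  simp only [Kernel.comap_apply]
  exact lintegral_lintegral_swap (f := fun a b => f ((z, b), a))
    (hf.comp (by fun_prop : Measurable fun x : α × β => ((z, x.2), x.1))).aemeasurable

end Rearrange

section CondMutualInfo

variable {Ω α β γ δ : Type*} [MeasurableSpace Ω]
    [MeasurableSpace α] [StandardBorelSpace α] [Nonempty α]
    [MeasurableSpace β] [MeasurableSpace γ] [MeasurableSpace δ]

/-- The law under which `X` and `Y` are conditionally independent given `Z`, when the law of `Y`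
given `Z` is represented by a function of `Z` and independent randomness. -/
theorem compProd_condDistrib_prod_paramKernel {X : Ω → α} {Z : Ω → γ} {μ : Measure Ω}
    [IsProbabilityMeasure μ] (hX : Measurable X) (hZ : Measurable Z) (m : Measure δ)
    [IsProbabilityMeasure m] {f : γ × δ → β} (hf : Measurable f) :
    (μ.map Z) ⊗ₘ (condDistrib X Z μ ×ₖ paramKernel m f) =
      ((μ.map fun w => (Z w, X w)).prod m).map fun x => (x.1.1, x.1.2, f (x.1.1, x.2)) := by
  have : IsProbabilityMeasure (μ.map Z) := Measure.isProbabilityMeasure_map hZ.aemeasurable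
  have := isMarkovKernel_paramKernel m hf
  have hm : Measurable fun x : (γ × α) × δ => (x.1.1, x.1.2, f (x.1.1, x.2)) :=
    measurable_fst.fst.prodMk (measurable_fst.snd.prodMk
      (hf.comp (measurable_fst.fst.prodMk measurable_snd)))
  refine Measure.ext_of_lintegral _ fun g hg => ?_
  have hgm : Measurable fun x : (γ × α) × δ => g (x.1.1, x.1.2, f (x.1.1, x.2)) := hg.comp hm
  rw [lintegral_compProd_prod _ _ _ hg, lintegral_map hg hm,
    lintegral_prod (fun x : (γ × α) × δ => g (x.1.1, x.1.2, f (x.1.1, x.2)))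
      hgm.aemeasurable, ← compProd_map_condDistrib hX.aemeasurable,
    Measure.lintegral_compProd hgm.lintegral_prod_right']
  refine lintegral_congr fun z => lintegral_congr fun a => ?_
  exact lintegral_paramKernel m hf z (hg.comp (measurable_prodMk_left.comp measurable_prodMk_left))

variable [StandardBorelSpace β] [Nonempty β]

/-- The golden formula, as an inequality: replacing the law of `Y` given `Z` by any other kernel
does not decrease the divergence. -/
theorem condMutualInfo_le_klDiv {X : Ω → α} {Y : Ω → β} {Z : Ω → γ} {μ : Measure Ω}
    [IsProbabilityMeasure μ] (hX : Measurable X) (hY : Measurable Y) (hZ : Measurable Z)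
    (Q : Kernel γ β) [IsMarkovKernel Q] :
    condMutualInfo X Y Z μ ≤ klDiv (μ.map (fun w => (Z w, X w, Y w)))
      ((μ.map Z) ⊗ₘ (condDistrib X Z μ ×ₖ Q)) := by
  have : IsProbabilityMeasure (μ.map Z) := Measure.isProbabilityMeasure_map hZ.aemeasurable
  have hXYZ : Measurable fun w => (Z w, X w, Y w) := hZ.prodMk (hX.prodMk hY)
  have hZY : Measurable fun w => (Z w, Y w) := hZ.prodMk hY
  have : IsProbabilityMeasure (μ.map fun w => (Z w, X w, Y w)) :=
    Measure.isProbabilityMeasure_map hXYZ.aemeasurable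
  have : IsProbabilityMeasure (μ.map fun w => (Z w, Y w)) :=
    Measure.isProbabilityMeasure_map hZY.aemeasurable
  have hP : (μ.map fun w => (Z w, X w, Y w)).map (rearrange γ α β) =
      (μ.map fun w => (Z w, Y w)) ⊗ₘ condDistrib X (fun w => (Z w, Y w)) μ := by
    rw [compProd_map_condDistrib hX.aemeasurable, Measure.map_map (rearrange γ α β).measurable hXYZ]
    rfl
  -- With `(Z, Y)` in front, the chain rule splits off the divergence of the law of `(Z, Y)` from
  -- `P_Z ⊗ Q`. The remaining term, from `X` given `(Z, Y)` against `X` given `Z`, does not involve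
  -- `Q` and equals the mutual information.
  rw [condMutualInfo, ← klDiv_map_measurableEquiv _ _ (rearrange γ α β), hP,
    ← klDiv_map_measurableEquiv (μ.map fun w => (Z w, X w, Y w)) _ (rearrange γ α β), hP,
    map_rearrange_compProd_prod, map_rearrange_compProd_prod,
    compProd_map_condDistrib hY.aemeasurable,
    klDiv_compProd_eq_add (ν := (μ.map Z) ⊗ₘ Q)]
  exact le_add_self

theorem condMutualInfo_le_klDiv_map {X : Ω → α} {Y : Ω → β} {Z : Ω → γ} {μ : Measure Ω}
    [IsProbabilityMeasure μ] (hX : Measurable X) (hY : Measurable Y) (hZ : Measurable Z)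
    (m : Measure δ) [IsProbabilityMeasure m] {f : γ × δ → β} (hf : Measurable f) :
    condMutualInfo X Y Z μ ≤ klDiv (μ.map (fun w => (Z w, X w, Y w)))
      (((μ.map fun w => (Z w, X w)).prod m).map fun x => (x.1.1, x.1.2, f (x.1.1, x.2))) := by
  have := isMarkovKernel_paramKernel m hf
  rw [← compProd_condDistrib_prod_paramKernel hX hZ m hf]
  exact condMutualInfo_le_klDiv hX hY hZ _

/-- The equality case of the golden formula. `hlaw` identifies the conditional law of `Y` given `Z`
only almost everywhere, which suffices after composing with the law of `Z`. -/
theorem condMutualInfo_eq_klDiv_map {X : Ω → α} {Y : Ω → β} {Z : Ω → γ} {μ : Measure Ω}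
    [IsProbabilityMeasure μ] (hX : Measurable X) (hY : Measurable Y) (hZ : Measurable Z)
    (m : Measure δ) [IsProbabilityMeasure m] {f : γ × δ → β} (hf : Measurable f)
    (hlaw : μ.map (fun w => (Z w, Y w)) = ((μ.map Z).prod m).map fun x => (x.1, f x)) :
    condMutualInfo X Y Z μ = klDiv (μ.map (fun w => (Z w, X w, Y w)))
      (((μ.map fun w => (Z w, X w)).prod m).map fun x => (x.1.1, x.1.2, f (x.1.1, x.2))) := by
  have : IsProbabilityMeasure (μ.map Z) := Measure.isProbabilityMeasure_map hZ.aemeasurable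
  have := isMarkovKernel_paramKernel m hf
  rw [← compProd_condDistrib_prod_paramKernel hX hZ m hf, condMutualInfo]
  rw [map_prod_eq_compProd_paramKernel _ _ hf] at hlaw
  have hae := condDistrib_ae_eq_of_measure_eq_compProd Z hY.aemeasurable hlaw
  congr 1
  refine Measure.compProd_congr ?_
  filter_upwards [hae] with z hz
  rw [Kernel.prod_apply, Kernel.prod_apply, hz]

end CondMutualInfo

/-! ### The scalar channel and the channel with several receivers -/

theorem isGaussianChannel_add {v : ℝ≥0} (hv : 0 < v) :
    IsGaussianChannel (complexGaussian v) (fun s n => s + n) (fun y => y) v 1 where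
  v_pos := hv
  measurable_shift := by fun_prop
  measurable_filter := measurable_id
  filter_shift s n := by simp
  map_shift s := complexGaussian_map_add_eq_withDensity hv.ne' s
  map_filter := by rw [mul_one]; exact Measure.map_id

/-- The exponents of the coordinatewise likelihood ratios add up: the linear terms depend on `y`
only through `∑ i, conj (h i) * y i`, and the quadratic terms give `|s|² ∑ i, |h i|²`. Hence this
filter and this gain. -/
theorem isGaussianChannel_pi {ι : Type*} [Fintype ι] {v : ℝ≥0} (hv : 0 < v) (h : ι → ℂ) :
    IsGaussianChannel (Measure.pi fun _ : ι => complexGaussian v) (fun s n i => h i * s + n i)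
      (fun y => ∑ i, starRingEnd ℂ (h i) * y i) v (∑ i, ‖h i‖₊ ^ 2) where
  v_pos := hv
  measurable_shift := measurable_pi_iff.2 fun i =>
    (measurable_fst.const_mul (h i)).add ((measurable_pi_apply i).comp measurable_snd)
  measurable_filter := Finset.measurable_sum _ fun i _ =>
    Measurable.const_mul (f := fun x : ι → ℂ => x i) (measurable_pi_apply i) _
  filter_shift s n := by
    simp only [mul_add, Finset.sum_add_distrib, ← mul_assoc, ← Finset.sum_mul]
    congr 2
    push_cast
    refine Finset.sum_congr rfl fun i _ => ?_
    rw [mul_comm, Complex.mul_conj, Complex.normSq_eq_norm_sq]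
    simp
  map_shift s := by
    have hm (i : ι) : Measurable fun y => ENNReal.ofReal (shiftDensity v 1 (h i * s) y) :=
      ((measurable_shiftDensity v 1).comp (measurable_const.prodMk measurable_id)).ennreal_ofReal
    have hp (i : ι) : IsProbabilityMeasure ((complexGaussian v).map (h i * s + ·)) :=
      Measure.isProbabilityMeasure_map (by fun_prop)
    have hsig (i : ι) : SigmaFinite ((complexGaussian v).withDensity fun y =>
        ENNReal.ofReal (shiftDensity v 1 (h i * s) y)) := by
      rw [← complexGaussian_map_add_eq_withDensity hv.ne']; infer_instance
    rw [Measure.pi_map_pi (f := fun i n => h i * s + n)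
      (fun i => (measurable_const_add (h i * s)).aemeasurable)]
    simp_rw [complexGaussian_map_add_eq_withDensity hv.ne']
    rw [pi_withDensity _ hm]
    congr 1
    ext y
    rw [← ENNReal.ofReal_prod_of_nonneg
      (f := fun i => shiftDensity v 1 (h i * s) (y i)) fun i _ => Real.exp_nonneg _]
    congr 1
    simp only [shiftDensity]
    rw [← Real.exp_sum, ← Finset.sum_div]
    congr 2
    simp only [Complex.re_sum, Complex.im_sum]
    push_cast
    rw [Finset.mul_sum, Finset.mul_sum, Finset.sum_mul, ← Finset.sum_add_distrib, Finset.mul_sum,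
      ← Finset.sum_sub_distrib]
    refine Finset.sum_congr rfl fun i _ => ?_
    rw [norm_mul, mul_pow]
    simp
    ring
  map_filter := by
    rw [map_sum_mul_pi_complexGaussian]
    simp

theorem map_restrict_pi {ι α : Type*} [Fintype ι] [MeasurableSpace α] (ν : Measure α)
    [IsProbabilityMeasure ν] (s : Finset ι) :
    (Measure.pi fun _ : ι => ν).map (fun x (i : {i // i ∈ s}) => x i) =
      Measure.pi fun _ : {i // i ∈ s} => ν := by
  classical
  have h := (measurePreserving_piEquivPiSubtypeProd (fun _ : ι => ν) (fun i => i ∈ s)).map_eq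
  have h2 := congrArg (Measure.map Prod.fst) h
  rw [Measure.map_map measurable_fst (MeasurableEquiv.measurable _), Measure.map_fst_prod,
    measure_univ, one_smul] at h2
  convert h2 using 2
  rfl

/-! ### Reduction of a cut to two parallel channels -/

namespace DiamondNetwork

variable {N : ℕ} (net : DiamondNetwork N) (Λ : Finset (Fin N))

/-- The noise variance `N₀ W`. -/
def noiseVar : ℝ≥0 := (net.N₀ * net.W).toNNReal

/-- The power constraint, as a nonnegative real. -/
def power : ℝ≥0 := net.P.toNNReal

theorem coe_noiseVar : (net.noiseVar : ℝ) = net.N₀ * net.W :=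
  Real.coe_toNNReal _ (mul_pos net.N₀_pos net.W_pos).le

theorem noiseVar_pos : 0 < net.noiseVar :=
  Real.toNNReal_pos.2 (mul_pos net.N₀_pos net.W_pos)

theorem coe_power : (net.power : ℝ) = net.P := Real.coe_toNNReal _ net.P_pos.le

theorem snr_eq : net.snr = net.power / net.noiseVar := by
  rw [snr, coe_power, coe_noiseVar]

theorem snr_pos : 0 < net.snr := div_pos net.P_pos (mul_pos net.N₀_pos net.W_pos)

/-- The split of the inputs into the known part `X_{Λᶜ}` and the rest. -/
def splitInputs (x : Inputs N) : ({i // i ∈ Λᶜ} → ℂ) × ℂ × ({i // i ∈ Λ} → ℂ) :=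
  (fun i => x.2 i, x.1, fun i => x.2 i)

/-- The noises that are relevant for the cut `Λ`. -/
def restrictNoises (z : Noises N) : ℂ × ({i // i ∈ Λᶜ} → ℂ) := (z.1, fun i => z.2 i)

theorem measurable_splitInputs : Measurable (splitInputs Λ) := by
  unfold splitInputs; fun_prop

theorem measurable_restrictNoises : Measurable (restrictNoises Λ) := by
  unfold restrictNoises; fun_prop

/-- The signal that the relays in `Λ` send jointly to the destination. -/
def jointSignal (x : {i // i ∈ Λ} → ℂ) : ℂ := ∑ i : {i // i ∈ Λ}, net.hd i * x i

theorem measurable_jointSignal : Measurable (net.jointSignal Λ) :=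
  Finset.measurable_sum _ fun i _ =>
    Measurable.const_mul (f := fun x : {i // i ∈ Λ} → ℂ => x i) (measurable_pi_apply i) _

/-- The output across the cut, in terms of the known inputs and of the output with the
contribution of the known inputs removed. -/
def shiftOutput (x : ({i // i ∈ Λᶜ} → ℂ) × ℂ × ({i // i ∈ Λᶜ} → ℂ)) :
    ℂ × ({i // i ∈ Λᶜ} → ℂ) :=
  (x.2.1 + net.jointSignal Λᶜ x.1, x.2.2)

theorem measurable_shiftOutput : Measurable (net.shiftOutput Λ) :=
  (measurable_snd.fst.add ((net.measurable_jointSignal Λᶜ).comp measurable_fst)).prodMk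
    measurable_snd.snd

/-- The measurable equivalence that adds the contribution of the known inputs to the output. -/
def shiftEquiv : (({i // i ∈ Λᶜ} → ℂ) × ℂ × ({i // i ∈ Λ} → ℂ)) × ℂ × ({i // i ∈ Λᶜ} → ℂ) ≃ᵐ
    ({i // i ∈ Λᶜ} → ℂ) × (ℂ × ({i // i ∈ Λ} → ℂ)) × ℂ × ({i // i ∈ Λᶜ} → ℂ) where
  toFun x := (x.1.1, x.1.2, net.shiftOutput Λ (x.1.1, x.2))
  invFun x := ((x.1, x.2.1), (x.2.2.1 - net.jointSignal Λᶜ x.1, x.2.2.2))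
  left_inv x := by simp [shiftOutput]
  right_inv x := by simp [shiftOutput]
  measurable_toFun := measurable_fst.fst.prodMk (measurable_fst.snd.prodMk
    ((net.measurable_shiftOutput Λ).comp (measurable_fst.fst.prodMk measurable_snd)))
  measurable_invFun := (measurable_fst.prodMk measurable_snd.fst).prodMk
    ((measurable_snd.snd.fst.sub ((net.measurable_jointSignal Λᶜ).comp measurable_fst)).prodMk
      measurable_snd.snd.snd)

/-- The output across the cut, up to the contribution of the known inputs. -/
def reducedOutput (t : ({i // i ∈ Λᶜ} → ℂ) × ℂ × ({i // i ∈ Λ} → ℂ))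
    (n : ℂ × ({i // i ∈ Λᶜ} → ℂ)) : ℂ × ({i // i ∈ Λᶜ} → ℂ) :=
  (net.jointSignal Λ t.2.2 + n.1, fun i => net.hs i * t.2.1 + n.2 i)

theorem measurable_reducedOutput :
    Measurable fun x : (({i // i ∈ Λᶜ} → ℂ) × ℂ × ({i // i ∈ Λ} → ℂ)) × ℂ × ({i // i ∈ Λᶜ} → ℂ) =>
      net.reducedOutput Λ x.1 x.2 :=
  (((net.measurable_jointSignal Λ).comp measurable_fst.snd.snd).add measurable_snd.fst).prodMk
    (measurable_pi_iff.2 fun i => (measurable_fst.snd.fst.const_mul (net.hs i)).add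
      ((measurable_pi_apply i).comp measurable_snd.snd))

theorem output_eq (w : Inputs N × Noises N) :
    (net.destOutput w, fun i : {i // i ∈ Λᶜ} => net.relayOutput i w) =
      net.shiftOutput Λ ((splitInputs Λ w.1).1,
        net.reducedOutput Λ (splitInputs Λ w.1) (restrictNoises Λ w.2)) := by
  have h : ∑ i, net.hd i * w.1.2 i = net.jointSignal Λ (fun i => w.1.2 i) +
      net.jointSignal Λᶜ (fun i => w.1.2 i) := by
    rw [jointSignal, jointSignal, Finset.sum_coe_sort Λ (fun i => net.hd i * w.1.2 i),
      Finset.sum_coe_sort Λᶜ (fun i => net.hd i * w.1.2 i), Finset.sum_add_sum_compl]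
  refine Prod.ext ?_ rfl
  simp only [destOutput, shiftOutput, reducedOutput, splitInputs, restrictNoises, h]
  ring

/-- The law of the noises that are relevant for the cut `Λ`. -/
def cutNoise : Measure (ℂ × ({i // i ∈ Λᶜ} → ℂ)) :=
  (complexGaussian net.noiseVar).prod (Measure.pi fun _ => complexGaussian net.noiseVar)

instance : IsProbabilityMeasure (net.cutNoise Λ) := by unfold cutNoise; infer_instance

theorem map_restrictNoises : net.noiseLaw.map (restrictNoises Λ) = net.cutNoise Λ := by
  have hm : Measurable fun (z : Fin N → ℂ) (i : {i // i ∈ Λᶜ}) => z i := by fun_prop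
  rw [cutNoise, ← map_restrict_pi (complexGaussian net.noiseVar) Λᶜ,
    ← Measure.map_id (μ := complexGaussian net.noiseVar), Measure.map_prod_map _ _ measurable_id
    (by simpa using hm), Measure.map_id]
  rfl

theorem measurable_split :
    Measurable fun w : Inputs N × Noises N => (splitInputs Λ w.1, restrictNoises Λ w.2) :=
  ((measurable_splitInputs Λ).comp measurable_fst).prodMk
    ((measurable_restrictNoises Λ).comp measurable_snd)

theorem map_split_jointLaw (μ : ProbabilityMeasure (Inputs N)) :
    (net.jointLaw μ).map (fun w => (splitInputs Λ w.1, restrictNoises Λ w.2)) =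
      ((μ : Measure (Inputs N)).map (splitInputs Λ)).prod (net.cutNoise Λ) := by
  rw [← net.map_restrictNoises, Measure.map_prod_map _ _ (measurable_splitInputs Λ)
    (measurable_restrictNoises Λ)]
  rfl

theorem map_splitInputs_jointLaw (μ : ProbabilityMeasure (Inputs N)) :
    (net.jointLaw μ).map (fun w => splitInputs Λ w.1) =
      (μ : Measure (Inputs N)).map (splitInputs Λ) := by
  have := congrArg (Measure.map Prod.fst) (net.map_split_jointLaw Λ μ)
  rw [Measure.map_map measurable_fst (measurable_split Λ), Measure.map_fst_prod, measure_univ,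
    one_smul] at this
  exact this

/-- The law of the reduced output when the inputs are independent Gaussian. -/
def cutOutput (p₁ p₂ : ℝ≥0) : Measure (ℂ × ({i // i ∈ Λᶜ} → ℂ)) :=
  (gaussianOutput (complexGaussian net.noiseVar) (fun s n => s + n) p₁).prod
    (gaussianOutput (Measure.pi fun _ : {i // i ∈ Λᶜ} => complexGaussian net.noiseVar)
      (fun s n i => net.hs i * s + n i) p₂)

instance (p₁ p₂ : ℝ≥0) : IsProbabilityMeasure (net.cutOutput Λ p₁ p₂) := by
  have := (isGaussianChannel_add net.noiseVar_pos).isProbabilityMeasure_gaussianOutput p₁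
  have := (isGaussianChannel_pi net.noiseVar_pos
    fun i : {i // i ∈ Λᶜ} => net.hs i).isProbabilityMeasure_gaussianOutput p₂
  unfold cutOutput; infer_instance

/-- The divergence that bounds the value of a cut, and equals it for Gaussian inputs. -/
theorem klDiv_cut (μ : ProbabilityMeasure (Inputs N))
    (h₁ : Integrable (fun x => ‖net.jointSignal Λ (fun i => x.2 i)‖ ^ 2) (μ : Measure (Inputs N)))
    (h₂ : Integrable (fun x => ‖x.1‖ ^ 2) (μ : Measure (Inputs N))) (p₁ p₂ : ℝ≥0) :
    klDiv ((net.jointLaw μ).map fun w => ((splitInputs Λ w.1).1, (splitInputs Λ w.1).2,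
        (net.destOutput w, fun i : {i // i ∈ Λᶜ} => net.relayOutput i w)))
      ((((net.jointLaw μ).map fun w => ((splitInputs Λ w.1).1, (splitInputs Λ w.1).2)).prod
        (net.cutOutput Λ p₁ p₂)).map
          fun x => (x.1.1, x.1.2, net.shiftOutput Λ (x.1.1, x.2))) =
      ENNReal.ofReal (Real.log (1 + p₁ / net.noiseVar) +
        (∫ x, ‖net.jointSignal Λ (fun i => x.2 i)‖ ^ 2 ∂(μ : Measure (Inputs N)) - p₁) /
          (net.noiseVar + p₁)) +
      ENNReal.ofReal (Real.log (1 + p₂ * (∑ i : {i // i ∈ Λᶜ}, ‖net.hs i‖ ^ 2) / net.noiseVar) +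
        (∑ i : {i // i ∈ Λᶜ}, ‖net.hs i‖ ^ 2) * (∫ x, ‖x.1‖ ^ 2 ∂(μ : Measure (Inputs N)) - p₂) /
          (net.noiseVar + p₂ * ∑ i : {i // i ∈ Λᶜ}, ‖net.hs i‖ ^ 2)) := by
  have hτ : IsProbabilityMeasure ((μ : Measure (Inputs N)).map (splitInputs Λ)) :=
    Measure.isProbabilityMeasure_map (measurable_splitInputs Λ).aemeasurable
  have hsplit : ((net.jointLaw μ).map
      fun w => ((splitInputs Λ w.1).1, (splitInputs Λ w.1).2)) =
      (μ : Measure (Inputs N)).map (splitInputs Λ) := net.map_splitInputs_jointLaw Λ μ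
  set τ := (μ : Measure (Inputs N)).map (splitInputs Λ) with hτdef
  have hmg : Measurable fun x : (({i // i ∈ Λᶜ} → ℂ) × ℂ × ({i // i ∈ Λ} → ℂ)) ×
      ℂ × ({i // i ∈ Λᶜ} → ℂ) => (x.1, net.reducedOutput Λ x.1 x.2) :=
    measurable_fst.prodMk (net.measurable_reducedOutput Λ)
  have hP : ((net.jointLaw μ).map fun w => ((splitInputs Λ w.1).1, (splitInputs Λ w.1).2,
        (net.destOutput w, fun i : {i // i ∈ Λᶜ} => net.relayOutput i w))) =
      ((τ.prod (net.cutNoise Λ)).map fun x => (x.1, net.reducedOutput Λ x.1 x.2)).map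
        (net.shiftEquiv Λ) := by
    rw [← net.map_split_jointLaw, Measure.map_map (net.shiftEquiv Λ).measurable hmg,
      Measure.map_map ((net.shiftEquiv Λ).measurable.comp hmg) (measurable_split Λ)]
    congr 1
    ext1 w
    rw [net.output_eq Λ w]
    rfl
  have : IsProbabilityMeasure
      ((τ.prod (net.cutNoise Λ)).map fun x => (x.1, net.reducedOutput Λ x.1 x.2)) :=
    Measure.isProbabilityMeasure_map hmg.aemeasurable
  have hms₁ : Measurable fun t : ({i // i ∈ Λᶜ} → ℂ) × ℂ × ({i // i ∈ Λ} → ℂ) =>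
      net.jointSignal Λ t.2.2 := (net.measurable_jointSignal Λ).comp measurable_snd.snd
  have hms₂ : Measurable fun t : ({i // i ∈ Λᶜ} → ℂ) × ℂ × ({i // i ∈ Λ} → ℂ) => t.2.1 :=
    measurable_snd.fst
  have hi₁ : Integrable (fun t => ‖net.jointSignal Λ t.2.2‖ ^ 2) τ := by
    rw [hτdef, integrable_map_measure (hms₁.norm.pow_const 2).aestronglyMeasurable
      (measurable_splitInputs Λ).aemeasurable]
    exact h₁
  have hi₂ : Integrable (fun t => ‖t.2.1‖ ^ 2) τ := by
    rw [hτdef, integrable_map_measure (hms₂.norm.pow_const 2).aestronglyMeasurable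
      (measurable_splitInputs Λ).aemeasurable]
    exact h₂
  have key := IsGaussianChannel.klDiv_parallel (isGaussianChannel_add net.noiseVar_pos)
    (isGaussianChannel_pi net.noiseVar_pos fun i : {i // i ∈ Λᶜ} => net.hs i) τ hms₁ hms₂ hi₁ hi₂
    p₁ p₂
  rw [hP, hsplit]
  -- Adding back the contribution of the known inputs is invertible, hence does not change the
  -- divergence.
  refine (klDiv_map_measurableEquiv _ _ (net.shiftEquiv Λ)).trans (key.trans ?_)
  rw [hτdef, integral_map (measurable_splitInputs Λ).aemeasurable
    (hms₁.norm.pow_const 2).aestronglyMeasurable, integral_map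
    (measurable_splitInputs Λ).aemeasurable (hms₂.norm.pow_const 2).aestronglyMeasurable]
  simp only [NNReal.coe_one, mul_one, one_mul, NNReal.coe_sum, NNReal.coe_pow, coe_nnnorm]
  rfl

end DiamondNetwork

/-! ### Second moments and independent groups of variables -/

theorem integral_norm_sq_le_of_lintegral {α : Type*} [MeasurableSpace α] {μ : Measure α}
    {f : α → ℂ} (hf : Measurable f) {P : ℝ} (hP : 0 ≤ P)
    (h : ∫⁻ x, ‖f x‖ₑ ^ 2 ∂μ ≤ ENNReal.ofReal P) :
    Integrable (fun x => ‖f x‖ ^ 2) μ ∧ ∫ x, ‖f x‖ ^ 2 ∂μ ≤ P := by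
  have hm : AEStronglyMeasurable (fun x => ‖f x‖ ^ 2) μ :=
    (hf.norm.pow_const 2).aestronglyMeasurable
  have he (x : α) : ‖f x‖ₑ ^ 2 = ENNReal.ofReal (‖f x‖ ^ 2) := by
    rw [ENNReal.ofReal_pow (norm_nonneg _), ofReal_norm]
  simp_rw [he] at h
  refine ⟨⟨hm, ?_⟩, ?_⟩
  · rw [hasFiniteIntegral_iff_ofReal (ae_of_all _ fun x => sq_nonneg _)]
    exact h.trans_lt ENNReal.ofReal_lt_top
  · rw [integral_eq_lintegral_of_nonneg_ae (ae_of_all _ fun x => sq_nonneg _) hm]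
    exact ENNReal.toReal_le_of_le_ofReal hP h

theorem lintegral_enorm_sq_complexGaussian (v : ℝ≥0) :
    ∫⁻ z, ‖z‖ₑ ^ 2 ∂complexGaussian v = v := by
  have he (z : ℂ) : ‖z‖ₑ ^ 2 = ENNReal.ofReal (‖z‖ ^ 2) := by
    rw [ENNReal.ofReal_pow (norm_nonneg _), ofReal_norm]
  simp_rw [he]
  rw [← ofReal_integral_eq_lintegral_ofReal (integrable_norm_sq_complexGaussian v)
    (ae_of_all _ fun x => sq_nonneg _), integral_norm_sq_complexGaussian, ENNReal.ofReal_coe_nnreal]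

/-- Cauchy-Schwarz with weights `‖c i‖`. The right side is linear in the `‖x i‖ ^ 2`, so individual
power bounds `P` give `P * (∑ ‖c i‖) ^ 2` in expectation, whatever the correlations. -/
theorem norm_sum_mul_sq_le {ι : Type*} (s : Finset ι) (c x : ι → ℂ) :
    ‖∑ i ∈ s, c i * x i‖ ^ 2 ≤ (∑ i ∈ s, ‖c i‖) * ∑ i ∈ s, ‖c i‖ * ‖x i‖ ^ 2 := by
  calc ‖∑ i ∈ s, c i * x i‖ ^ 2 ≤ (∑ i ∈ s, ‖c i‖ * ‖x i‖) ^ 2 := by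
        gcongr
        exact (norm_sum_le _ _).trans_eq (Finset.sum_congr rfl fun i _ => norm_mul _ _)
    _ ≤ _ := Finset.sum_sq_le_sum_mul_sum_of_sq_le_mul _ (fun i _ => norm_nonneg _)
        (fun i _ => by positivity) fun i _ => by
          rw [mul_pow, sq ‖c i‖, mul_assoc]

theorem map_restrict_compl_prod_pi {ι α : Type*} [Fintype ι] [DecidableEq ι] [MeasurableSpace α]
    (ν : Measure α) [IsProbabilityMeasure ν] (s : Finset ι) :
    (Measure.pi fun _ : ι => ν).map
        (fun x => ((fun i : {i // i ∈ sᶜ} => x i), (fun i : {i // i ∈ s} => x i))) =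
      (Measure.pi fun _ : {i // i ∈ sᶜ} => ν).prod (Measure.pi fun _ : {i // i ∈ s} => ν) := by
  have h : iIndepFun (fun (i : ι) (x : ι → α) => x i) (Measure.pi fun _ : ι => ν) :=
    iIndepFun_pi (X := fun _ => id) fun _ => aemeasurable_id
  have h2 := h.indepFun_finset sᶜ s disjoint_compl_left fun i => measurable_pi_apply i
  have hm (t : Finset ι) : Measurable fun (x : ι → α) (i : {i // i ∈ t}) => x i := by fun_prop
  rw [indepFun_iff_map_prod_eq_prod_map_map (hm sᶜ).aemeasurable (hm s).aemeasurable, map_restrict_pi,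
    map_restrict_pi] at h2
  exact h2

/-- Independent variables, mapped in two independent groups. -/
theorem map_prod_pairs {B S K E₁ E₂ Y₁ Y₂ : Type*} [MeasurableSpace B] [MeasurableSpace S]
    [MeasurableSpace K] [MeasurableSpace E₁] [MeasurableSpace E₂] [MeasurableSpace Y₁]
    [MeasurableSpace Y₂] (b : Measure B) [IsProbabilityMeasure b] (σ : Measure S)
    [IsProbabilityMeasure σ] (κ : Measure K) [IsProbabilityMeasure κ] (ν₁ : Measure E₁)
    [IsProbabilityMeasure ν₁] (ν₂ : Measure E₂) [IsProbabilityMeasure ν₂] {g₁ : K × E₁ → Y₁}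
    {g₂ : S × E₂ → Y₂} (hg₁ : Measurable g₁) (hg₂ : Measurable g₂) :
    ((b.prod (σ.prod κ)).prod (ν₁.prod ν₂)).map
        (fun x => (x.1.1, (g₁ (x.1.2.2, x.2.1), g₂ (x.1.2.1, x.2.2)))) =
      b.prod (((κ.prod ν₁).map g₁).prod ((σ.prod ν₂).map g₂)) := by
  -- Permuting the factors of a product measure: two applications of Tonelli, exchanging first `s`
  -- and `k`, then `s` and the first noise.
  have hr : ((b.prod (σ.prod κ)).prod (ν₁.prod ν₂)).map
      (fun x => (x.1.1, ((x.1.2.2, x.2.1), (x.1.2.1, x.2.2)))) =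
      b.prod ((κ.prod ν₁).prod (σ.prod ν₂)) := by
    refine Measure.ext_of_lintegral _ fun f hf => ?_
    have h1 : Measurable fun x : (B × S × K) × E₁ × E₂ =>
        f (x.1.1, ((x.1.2.2, x.2.1), (x.1.2.1, x.2.2))) := hf.comp (by fun_prop)
    have h2 : Measurable fun x : B × S × K => ∫⁻ y : E₁ × E₂,
        f (x.1, ((x.2.2, y.1), (x.2.1, y.2))) ∂(ν₁.prod ν₂) := h1.lintegral_prod_right'
    rw [lintegral_map hf (by fun_prop), lintegral_prod _ h1.aemeasurable,
      lintegral_prod _ h2.aemeasurable, lintegral_prod _ hf.aemeasurable]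
    refine lintegral_congr fun z => ?_
    have h3 : Measurable fun x : S × K => ∫⁻ y : E₁ × E₂,
        f (z, ((x.2, y.1), (x.1, y.2))) ∂(ν₁.prod ν₂) := h2.comp measurable_prodMk_left
    have h4 : Measurable fun x : (K × E₁) × S × E₂ => f (z, x) := hf.comp measurable_prodMk_left
    have h5 : Measurable fun x : K × E₁ => ∫⁻ y : S × E₂, f (z, (x, y)) ∂(σ.prod ν₂) :=
      h4.lintegral_prod_right'
    rw [lintegral_prod _ h3.aemeasurable, lintegral_lintegral_swap (f := fun s k =>
        ∫⁻ y : E₁ × E₂, f (z, ((k, y.1), (s, y.2))) ∂(ν₁.prod ν₂)) h3.aemeasurable,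
      lintegral_prod _ h4.aemeasurable, lintegral_prod _ h5.aemeasurable]
    refine lintegral_congr fun k => ?_
    have h6 : Measurable fun x : S × E₁ × E₂ => f (z, ((k, x.2.1), (x.1, x.2.2))) :=
      hf.comp (by fun_prop)
    have h7 (s : S) : Measurable fun y : E₁ × E₂ => f (z, ((k, y.1), (s, y.2))) :=
      hf.comp (by fun_prop)
    have h8 : Measurable fun x : (S × E₁) × E₂ => f (z, ((k, x.1.2), (x.1.1, x.2))) :=
      hf.comp (by fun_prop)
    have h9 (e : E₁) : Measurable fun y : S × E₂ => f (z, ((k, e), y)) := hf.comp (by fun_prop)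
    simp_rw [lintegral_prod _ (h7 _).aemeasurable, lintegral_prod _ (h9 _).aemeasurable]
    exact lintegral_lintegral_swap (f := fun s e => ∫⁻ y, f (z, ((k, e), (s, y))) ∂ν₂)
      h8.lintegral_prod_right'.aemeasurable
  have := Measure.isProbabilityMeasure_map (μ := κ.prod ν₁) hg₁.aemeasurable
  have := Measure.isProbabilityMeasure_map (μ := σ.prod ν₂) hg₂.aemeasurable
  rw [Measure.map_prod_map _ _ hg₁ hg₂]
  nth_rw 2 [← Measure.map_id (μ := b)]
  rw [Measure.map_prod_map _ _ measurable_id (hg₁.prodMap hg₂), ← hr,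
    Measure.map_map (measurable_id.prodMap (hg₁.prodMap hg₂)) (by fun_prop)]
  rfl

/-! ### Cut values: general upper bound and exact value for Gaussian inputs -/

namespace DiamondNetwork

variable {N : ℕ} (net : DiamondNetwork N) (Λ : Finset (Fin N))

theorem measurable_destOutput : Measurable net.destOutput :=
  (Finset.measurable_sum _ fun i _ =>
    Measurable.const_mul (f := fun w : Inputs N × Noises N => w.1.2 i)
      ((measurable_pi_apply i).comp measurable_fst.snd) (net.hd i)).add
      measurable_snd.fst

theorem measurable_output : Measurable fun w : Inputs N × Noises N =>
    (net.destOutput w, fun i : {i // i ∈ Λᶜ} => net.relayOutput i w) :=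
  net.measurable_destOutput.prodMk (measurable_pi_iff.2 fun i =>
    (measurable_fst.fst.const_mul (net.hs i)).add
      ((measurable_pi_apply i.1).comp measurable_snd.snd))

/-- The comparison powers `p₁`, `p₂` dominate the actual second moments, so the correction terms in
`klDiv_cut` are nonpositive and can be dropped. -/
theorem cutValue_le_of_moments (μ : ProbabilityMeasure (Inputs N)) {p₁ p₂ : ℝ≥0}
    (h₁ : Integrable (fun x => ‖net.jointSignal Λ (fun i => x.2 i)‖ ^ 2) (μ : Measure (Inputs N)))
    (h₂ : Integrable (fun x => ‖x.1‖ ^ 2) (μ : Measure (Inputs N)))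
    (hp₁ : ∫ x, ‖net.jointSignal Λ (fun i => x.2 i)‖ ^ 2 ∂(μ : Measure (Inputs N)) ≤ p₁)
    (hp₂ : ∫ x, ‖x.1‖ ^ 2 ∂(μ : Measure (Inputs N)) ≤ p₂) :
    net.cutValue μ Λ ≤ ENNReal.ofReal (Real.logb 2 (1 + p₁ / net.noiseVar) +
      Real.logb 2 (1 + p₂ * (∑ i : {i // i ∈ Λᶜ}, ‖net.hs i‖ ^ 2) / net.noiseVar)) := by
  have hv : (0 : ℝ) < net.noiseVar := net.noiseVar_pos
  have hG : 0 ≤ ∑ i : {i // i ∈ Λᶜ}, ‖net.hs i‖ ^ 2 := Finset.sum_nonneg fun i _ => sq_nonneg _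
  have hl : 0 < Real.log 2 := Real.log_pos one_lt_two
  have hb := (condMutualInfo_le_klDiv_map (μ := net.jointLaw μ)
    ((measurable_splitInputs Λ).comp measurable_fst).snd (net.measurable_output Λ)
    ((measurable_splitInputs Λ).comp measurable_fst).fst (net.cutOutput Λ p₁ p₂)
    (net.measurable_shiftOutput Λ)).trans_eq (net.klDiv_cut Λ μ h₁ h₂ p₁ p₂)
  rw [Real.logb, Real.logb, ← add_div, ENNReal.ofReal_div_of_pos hl, ENNReal.ofReal_add
    (Real.log_nonneg (by simp; positivity)) (Real.log_nonneg (by simp; positivity))]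
  refine ENNReal.div_le_div_right (hb.trans (add_le_add (ENNReal.ofReal_le_ofReal ?_)
    (ENNReal.ofReal_le_ofReal ?_))) _
  · exact add_le_of_nonpos_right (div_nonpos_of_nonpos_of_nonneg (by linarith) (by positivity))
  · exact add_le_of_nonpos_right (div_nonpos_of_nonpos_of_nonneg
      (mul_nonpos_of_nonneg_of_nonpos hG (by linarith)) (by positivity))

/-- Independent Gaussian inputs of full power. -/
def gaussianInputs : ProbabilityMeasure (Inputs N) :=
  ⟨(complexGaussian net.power).prod (Measure.pi fun _ : Fin N => complexGaussian net.power),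
    inferInstance⟩

theorem coe_gaussianInputs : (net.gaussianInputs : Measure (Inputs N)) =
    (complexGaussian net.power).prod (Measure.pi fun _ : Fin N => complexGaussian net.power) :=
  rfl

theorem map_fst_gaussianInputs :
    (net.gaussianInputs : Measure (Inputs N)).map Prod.fst = complexGaussian net.power := by
  rw [coe_gaussianInputs, Measure.map_fst_prod, measure_univ, one_smul]

theorem map_snd_gaussianInputs : (net.gaussianInputs : Measure (Inputs N)).map Prod.snd =
    Measure.pi fun _ : Fin N => complexGaussian net.power := by
  rw [coe_gaussianInputs, Measure.map_snd_prod, measure_univ, one_smul]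

theorem meetsPower_gaussianInputs : net.MeetsPower net.gaussianInputs := by
  have hm : Measurable fun z : ℂ => ‖z‖ₑ ^ 2 := by fun_prop
  have h := lintegral_enorm_sq_complexGaussian net.power
  refine ⟨?_, fun i => ?_⟩
  · rw [← net.map_fst_gaussianInputs, lintegral_map hm measurable_fst] at h
    exact h.le
  · have he : (Measure.pi fun _ : Fin N => complexGaussian net.power).map (fun x => x i) =
        complexGaussian net.power := by
      have := Measure.pi_map_eval (fun _ : Fin N => complexGaussian net.power) i
      simpa using this
    rw [← he, ← net.map_snd_gaussianInputs, lintegral_map hm (measurable_pi_apply i),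
      lintegral_map (f := fun x : Fin N → ℂ => ‖x i‖ₑ ^ 2) (by fun_prop) measurable_snd] at h
    exact h.le

theorem map_splitInputs_gaussianInputs :
    (net.gaussianInputs : Measure (Inputs N)).map (splitInputs Λ) =
      (Measure.pi fun _ : {i // i ∈ Λᶜ} => complexGaussian net.power).prod
        ((complexGaussian net.power).prod
          (Measure.pi fun _ : {i // i ∈ Λ} => complexGaussian net.power)) := by
  have hr : Measurable fun x : Fin N → ℂ =>
      ((fun i : {i // i ∈ Λᶜ} => x i), (fun i : {i // i ∈ Λ} => x i)) := by fun_prop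
  refine Measure.ext_of_lintegral _ fun f hf => ?_
  have h1 : Measurable fun x : ℂ × ({i // i ∈ Λᶜ} → ℂ) × ({i // i ∈ Λ} → ℂ) =>
    f (x.2.1, x.1, x.2.2) := hf.comp (by fun_prop)
  have h2 (s : ℂ) : Measurable fun x : ({i // i ∈ Λᶜ} → ℂ) × ({i // i ∈ Λ} → ℂ) =>
    f (x.1, s, x.2) := hf.comp (by fun_prop)
  have h3 : Measurable fun x : (ℂ × ({i // i ∈ Λᶜ} → ℂ)) × ({i // i ∈ Λ} → ℂ) =>
    f (x.1.2, x.1.1, x.2) := hf.comp (by fun_prop)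
  have h4 (b : {i // i ∈ Λᶜ} → ℂ) : Measurable fun x : ℂ × ({i // i ∈ Λ} → ℂ) =>
    f (b, x) := hf.comp measurable_prodMk_left
  have h5 : Measurable fun x : Inputs N => f (splitInputs Λ x) :=
    hf.comp (measurable_splitInputs Λ)
  rw [lintegral_map hf (measurable_splitInputs Λ), coe_gaussianInputs,
    lintegral_prod _ h5.aemeasurable, lintegral_prod _ hf.aemeasurable]
  have h6 (s : ℂ) : ∫⁻ x, f (splitInputs Λ (s, x))
      ∂(Measure.pi fun _ : Fin N => complexGaussian net.power) =
      ∫⁻ b, ∫⁻ c, f (b, s, c) ∂(Measure.pi fun _ : {i // i ∈ Λ} => complexGaussian net.power)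
        ∂(Measure.pi fun _ : {i // i ∈ Λᶜ} => complexGaussian net.power) := by
    rw [← lintegral_prod _ (h2 s).aemeasurable, ← map_restrict_compl_prod_pi,
      lintegral_map (h2 s) hr]
    rfl
  simp_rw [h6, lintegral_prod _ (h4 _).aemeasurable]
  exact lintegral_lintegral_swap (f := fun s b => ∫⁻ c, f (b, s, c)
    ∂(Measure.pi fun _ : {i // i ∈ Λ} => complexGaussian net.power))
    h3.lintegral_prod_right'.aemeasurable

/-- The power of the joint signal of the relays in `Λ` for independent inputs of full power. -/
def jointPower : ℝ≥0 := net.power * ∑ i : {i // i ∈ Λ}, ‖net.hd i‖₊ ^ 2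

theorem map_jointSignal : (Measure.pi fun _ : {i // i ∈ Λ} => complexGaussian net.power).map
    (net.jointSignal Λ) = complexGaussian (net.jointPower Λ) :=
  map_sum_mul_pi_complexGaussian net.power fun i : {i // i ∈ Λ} => net.hd i

theorem map_jointSignal_gaussianInputs : (net.gaussianInputs : Measure (Inputs N)).map
    (fun x => net.jointSignal Λ (fun i => x.2 i)) = complexGaussian (net.jointPower Λ) := by
  have hr : Measurable fun (x : Fin N → ℂ) (i : {i // i ∈ Λ}) => x i := by fun_prop
  rw [← net.map_jointSignal, ← map_restrict_pi, ← net.map_snd_gaussianInputs,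
    Measure.map_map hr measurable_snd,
    Measure.map_map (net.measurable_jointSignal Λ) (hr.comp measurable_snd)]
  rfl

/-- For independent inputs the reduced output is independent of `X_{Λᶜ}`, and the two groups `(X_Λ,
Z)` and `(X_s, Z_{Λᶜ})` are independent of each other. This is the equality condition of the golden
formula. -/
theorem map_output_gaussianInputs :
    (net.jointLaw net.gaussianInputs).map (fun w => ((splitInputs Λ w.1).1,
      (net.destOutput w, fun i : {i // i ∈ Λᶜ} => net.relayOutput i w))) =
    (((net.jointLaw net.gaussianInputs).map fun w => (splitInputs Λ w.1).1).prod
      (net.cutOutput Λ (net.jointPower Λ) net.power)).map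
        fun x => (x.1, net.shiftOutput Λ x) := by
  have hms : Measurable fun x : ({i // i ∈ Λᶜ} → ℂ) × ℂ × ({i // i ∈ Λᶜ} → ℂ) =>
    (x.1, net.shiftOutput Λ x) := measurable_fst.prodMk (net.measurable_shiftOutput Λ)
  have hmr : Measurable fun x : (({i // i ∈ Λᶜ} → ℂ) × ℂ × ({i // i ∈ Λ} → ℂ)) ×
      ℂ × ({i // i ∈ Λᶜ} → ℂ) => (x.1.1, net.reducedOutput Λ x.1 x.2) :=
    measurable_fst.fst.prodMk (net.measurable_reducedOutput Λ)
  have hZ : (net.jointLaw net.gaussianInputs).map (fun w => (splitInputs Λ w.1).1) =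
      Measure.pi fun _ : {i // i ∈ Λᶜ} => complexGaussian net.power := by
    have hs : Measurable fun w : Inputs N × Noises N => splitInputs Λ w.1 :=
      (measurable_splitInputs Λ).comp measurable_fst
    have := congrArg (Measure.map Prod.fst) (net.map_splitInputs_jointLaw Λ net.gaussianInputs)
    rw [map_splitInputs_gaussianInputs, Measure.map_fst_prod, measure_univ, one_smul,
      Measure.map_map measurable_fst hs] at this
    exact this
  have hg₁ : Measurable fun x : ({i // i ∈ Λ} → ℂ) × ℂ => net.jointSignal Λ x.1 + x.2 :=
    ((net.measurable_jointSignal Λ).comp measurable_fst).add measurable_snd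
  have hg₂ : Measurable fun (x : ℂ × ({i // i ∈ Λᶜ} → ℂ)) (i : {i // i ∈ Λᶜ}) =>
      net.hs i * x.1 + x.2 i :=
    (isGaussianChannel_pi net.noiseVar_pos fun i : {i // i ∈ Λᶜ} => net.hs i).measurable_shift
  -- The scalar channel sees `X_Λ` only through the joint signal, which is itself complex Gaussian.
  have hout : gaussianOutput (complexGaussian net.noiseVar) (fun s n => s + n)
      (net.jointPower Λ) = ((Measure.pi fun _ : {i // i ∈ Λ} => complexGaussian net.power).prod
        (complexGaussian net.noiseVar)).map (fun x => net.jointSignal Λ x.1 + x.2) := by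
    rw [gaussianOutput, ← net.map_jointSignal]
    nth_rw 1 [← Measure.map_id (μ := complexGaussian net.noiseVar)]
    rw [Measure.map_prod_map _ _ (net.measurable_jointSignal Λ) measurable_id,
      Measure.map_map (by fun_prop) ((net.measurable_jointSignal Λ).prodMap measurable_id)]
    rfl
  have hred : (((net.gaussianInputs : Measure (Inputs N)).map (splitInputs Λ)).prod
      (net.cutNoise Λ)).map (fun x => (x.1.1, net.reducedOutput Λ x.1 x.2)) =
      (Measure.pi fun _ : {i // i ∈ Λᶜ} => complexGaussian net.power).prod
        (net.cutOutput Λ (net.jointPower Λ) net.power) := by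
    rw [map_splitInputs_gaussianInputs, cutNoise, cutOutput, hout]
    exact map_prod_pairs _ _ _ _ _ hg₁ hg₂
  rw [hZ, ← hred, ← map_split_jointLaw, Measure.map_map hmr (measurable_split Λ),
    Measure.map_map hms (hmr.comp (measurable_split Λ))]
  congr 1
  ext1 w
  rw [net.output_eq Λ w]
  rfl

theorem cutValue_gaussianInputs : net.cutValue net.gaussianInputs Λ =
    ENNReal.ofReal (Real.logb 2 (1 + net.jointPower Λ / net.noiseVar) +
      Real.logb 2
        (1 + net.power * (∑ i : {i // i ∈ Λᶜ}, ‖net.hs i‖ ^ 2) / net.noiseVar)) := by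
  have hv : (0 : ℝ) < net.noiseVar := net.noiseVar_pos
  have hG : 0 ≤ ∑ i : {i // i ∈ Λᶜ}, ‖net.hs i‖ ^ 2 := Finset.sum_nonneg fun i _ => sq_nonneg _
  have hl : 0 < Real.log 2 := Real.log_pos one_lt_two
  have hms : Measurable fun x : Inputs N => net.jointSignal Λ (fun i => x.2 i) :=
    (net.measurable_jointSignal Λ).comp (by fun_prop)
  have i1 := integrable_norm_sq_complexGaussian (net.jointPower Λ)
  have i2 := integrable_norm_sq_complexGaussian net.power
  have e1 := integral_norm_sq_complexGaussian (net.jointPower Λ)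
  have e2 := integral_norm_sq_complexGaussian net.power
  rw [← net.map_jointSignal_gaussianInputs] at i1 e1
  rw [← net.map_fst_gaussianInputs] at i2 e2
  rw [integrable_map_measure (by fun_prop) hms.aemeasurable] at i1
  rw [integrable_map_measure (by fun_prop) measurable_fst.aemeasurable] at i2
  rw [integral_map hms.aemeasurable (by fun_prop)] at e1
  rw [integral_map measurable_fst.aemeasurable (by fun_prop)] at e2
  have hb := (condMutualInfo_eq_klDiv_map (μ := net.jointLaw net.gaussianInputs)
    ((measurable_splitInputs Λ).comp measurable_fst).snd (net.measurable_output Λ)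
    ((measurable_splitInputs Λ).comp measurable_fst).fst
    (net.cutOutput Λ (net.jointPower Λ) net.power)
    (net.measurable_shiftOutput Λ) (net.map_output_gaussianInputs Λ)).trans
    (net.klDiv_cut Λ net.gaussianInputs i1 i2 _ _)
  -- The actual moments equal the comparison powers, so the corrections vanish.
  rw [e1, e2, sub_self, sub_self, mul_zero, zero_div, zero_div, add_zero, add_zero,
    ← ENNReal.ofReal_add (Real.log_nonneg (by simp; positivity))
      (Real.log_nonneg (by simp; positivity))] at hb
  rw [Real.logb, Real.logb, ← add_div, ENNReal.ofReal_div_of_pos hl, ← hb]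
  rfl

end DiamondNetwork

/-! ### Elementary inequalities for rates and for the gap -/

theorem exists_mem_maxOver_eq {N : ℕ} {Λ : Finset (Fin N)} (hΛ : Λ.Nonempty) (R : Fin N → ℝ) :
    ∃ j ∈ Λ, maxOver Λ R = R j ∧ ∀ i ∈ Λ, R i ≤ R j := by
  obtain ⟨j, hj, he⟩ := Finset.exists_mem_eq_sup' hΛ R
  refine ⟨j, hj, by rw [maxOver, dif_pos hΛ, he], fun i hi => ?_⟩
  rw [← he]
  exact Finset.le_sup' R hi

theorem maxOver_empty {N : ℕ} (R : Fin N → ℝ) : maxOver ∅ R = 0 := by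
  rw [maxOver, dif_neg Finset.not_nonempty_empty]

section Capacity

variable {N : ℕ} {s : ℝ} (Λ : Finset (Fin N)) (a : Fin N → ℝ)

theorem sq_le_of_logb_le (hs : 0 < s) {x y : ℝ}
    (h : Real.logb 2 (1 + s * x ^ 2) ≤ Real.logb 2 (1 + s * y ^ 2)) : x ^ 2 ≤ y ^ 2 := by
  rw [Real.logb_le_logb one_lt_two (by positivity) (by positivity)] at h
  exact le_of_mul_le_mul_left (by linarith) hs

/-- The gain of maximal ratio combining over selecting the best of `k` branches is at most
`log₂ k`. -/
theorem logb_sum_sq_le (hs : 0 < s) :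
    Real.logb 2 (1 + s * ∑ i ∈ Λ, a i ^ 2) ≤
      maxOver Λ (fun i => Real.logb 2 (1 + s * a i ^ 2)) + Real.logb 2 Λ.card := by
  rcases Λ.eq_empty_or_nonempty with rfl | hΛ
  -- Here `Real.logb 2 0 = 0` by convention, so both sides vanish.
  · simp [maxOver_empty]
  obtain ⟨j, -, he, hj⟩ := exists_mem_maxOver_eq hΛ fun i => Real.logb 2 (1 + s * a i ^ 2)
  have hk : (1 : ℝ) ≤ Λ.card := by exact_mod_cast hΛ.card_pos
  rw [he, ← Real.logb_mul (by positivity) (by positivity)]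
  refine Real.logb_le_logb_of_le one_lt_two (by positivity) ?_
  have h : ∑ i ∈ Λ, a i ^ 2 ≤ Λ.card * a j ^ 2 := by
    rw [← nsmul_eq_mul]
    exact Finset.sum_le_card_nsmul _ _ _ fun i hi => sq_le_of_logb_le hs (hj i hi)
  have := mul_le_mul_of_nonneg_left h hs.le
  -- From `k ≥ 1`: `1 + s k a² ≤ k (1 + s a²)`.
  nlinarith

/-- The beamforming gain over selecting the best of `k` branches is at most `2 log₂ k`. -/
theorem logb_sq_sum_le (hs : 0 < s) (ha : ∀ i, 0 ≤ a i) :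
    Real.logb 2 (1 + s * (∑ i ∈ Λ, a i) ^ 2) ≤
      maxOver Λ (fun i => Real.logb 2 (1 + s * a i ^ 2)) + 2 * Real.logb 2 Λ.card := by
  rcases Λ.eq_empty_or_nonempty with rfl | hΛ
  · simp [maxOver_empty]
  obtain ⟨j, -, he, hj⟩ := exists_mem_maxOver_eq hΛ fun i => Real.logb 2 (1 + s * a i ^ 2)
  have hk : (1 : ℝ) ≤ Λ.card := by exact_mod_cast hΛ.card_pos
  have hp : 2 * Real.logb 2 (Λ.card : ℝ) = Real.logb 2 ((Λ.card : ℝ) ^ 2) := by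
    rw [Real.logb_pow]; norm_num
  rw [he, hp, ← Real.logb_mul (by positivity) (by positivity)]
  refine Real.logb_le_logb_of_le one_lt_two (by positivity) ?_
  have h : ∑ i ∈ Λ, a i ≤ Λ.card * a j := by
    rw [← nsmul_eq_mul]
    exact Finset.sum_le_card_nsmul _ _ _ fun i hi =>
      (sq_le_sq₀ (ha i) (ha j)).1 (sq_le_of_logb_le hs (hj i hi))
  have h2 : (∑ i ∈ Λ, a i) ^ 2 ≤ (Λ.card * a j) ^ 2 :=
    pow_le_pow_left₀ (Finset.sum_nonneg fun i _ => ha i) h 2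
  have := mul_le_mul_of_nonneg_left h2 hs.le
  have := one_le_pow₀ hk (n := 2)
  linarith

theorem maxOver_logb_le (hs : 0 < s) :
    maxOver Λ (fun i => Real.logb 2 (1 + s * a i ^ 2)) ≤
      Real.logb 2 (1 + s * ∑ i ∈ Λ, a i ^ 2) := by
  rcases Λ.eq_empty_or_nonempty with rfl | hΛ
  · simp [maxOver_empty]
  obtain ⟨j, hj, he, -⟩ := exists_mem_maxOver_eq hΛ fun i => Real.logb 2 (1 + s * a i ^ 2)
  rw [he]
  refine Real.logb_le_logb_of_le one_lt_two (by positivity) ?_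
  have := Finset.single_le_sum (f := fun i => a i ^ 2) (fun i _ => sq_nonneg _) hj
  gcongr

end Capacity

theorem logb_card_le_beamformingGap {N : ℕ} (Λ : Finset (Fin N)) :
    2 * Real.logb 2 Λ.card + Real.logb 2 Λᶜ.card ≤ beamformingGap N := by
  rcases Nat.eq_zero_or_pos N with rfl | hN
  · simp [beamformingGap, Finset.eq_empty_of_isEmpty]
  have hN' : (1 : ℝ) ≤ N := by exact_mod_cast hN
  have hlog : 0 ≤ Real.logb 2 N := Real.logb_nonneg one_lt_two hN'
  have hc : (Λ.card : ℝ) + Λᶜ.card = N := by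
    have := Λ.card_add_card_compl
    rw [Fintype.card_fin] at this
    exact_mod_cast this
  rcases Nat.eq_zero_or_pos Λ.card with hk | hk
  · rw [hk, Nat.cast_zero, zero_add] at hc
    -- For the empty cut the junk value `logb 2 0 = 0` leaves `log₂ N ≤ 2 log₂ N`.
    rw [hk, hc, Nat.cast_zero, Real.logb_zero, mul_zero, zero_add]
    exact le_max_of_le_right (by linarith)
  rcases Nat.eq_zero_or_pos Λᶜ.card with hm | hm
  · rw [hm, Nat.cast_zero, add_zero] at hc
    rw [hm, hc, Nat.cast_zero, Real.logb_zero, add_zero]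
    exact le_max_right _ _
  have hk' : (0 : ℝ) < Λ.card := by exact_mod_cast hk
  have hm' : (0 : ℝ) < Λᶜ.card := by exact_mod_cast hm
  refine le_max_of_le_left ?_
  have e1 : 2 * Real.logb 2 (Λ.card : ℝ) = Real.logb 2 ((Λ.card : ℝ) ^ 2) := by
    rw [Real.logb_pow]; norm_num
  have e2 : 3 * Real.logb 2 (N : ℝ) = Real.logb 2 ((N : ℝ) ^ 3) := by
    rw [Real.logb_pow]; norm_num
  rw [e1, e2, ← Real.logb_mul (by positivity) (by positivity),
    ← Real.logb_div (by positivity) (by positivity)]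
  refine Real.logb_le_logb_of_le one_lt_two (by positivity) ?_
  rw [le_div_iff₀ (by norm_num), ← hc]
  generalize (Λ.card : ℝ) = k at *
  generalize (Λᶜ.card : ℝ) = m at *
  -- The identity `4 (k + m)³ - 27 k² m = (4k + m) (2m - k)²`, with equality in the bound at `k =
  -- 2m`.
  nlinarith [mul_nonneg (add_pos (mul_pos (by norm_num : (0 : ℝ) < 4) hk') hm').le
    (sq_nonneg (2 * m - k))]

/-! ### The two bounds on the cut-set bound -/

namespace DiamondNetwork

variable {N : ℕ} (net : DiamondNetwork N) (Λ : Finset (Fin N))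

/-- The second moment of the joint signal of the relays in `Λ` is largest when they send fully
correlated signals. -/
theorem integral_jointSignal_le {μ : ProbabilityMeasure (Inputs N)} (hμ : net.MeetsPower μ) :
    Integrable (fun x => ‖net.jointSignal Λ (fun i => x.2 i)‖ ^ 2) (μ : Measure (Inputs N)) ∧
    ∫ x, ‖net.jointSignal Λ (fun i => x.2 i)‖ ^ 2 ∂(μ : Measure (Inputs N)) ≤
      net.P * (∑ i ∈ Λ, ‖net.hd i‖) ^ 2 := by
  have hm : Measurable fun x : Inputs N => net.jointSignal Λ (fun i => x.2 i) :=
    (net.measurable_jointSignal Λ).comp (by fun_prop)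
  have hi (i : Fin N) := integral_norm_sq_le_of_lintegral (μ := (μ : Measure (Inputs N)))
    (f := fun x => x.2 i) (by fun_prop) net.P_pos.le (hμ.2 i)
  have hle (x : Inputs N) : ‖net.jointSignal Λ (fun i => x.2 i)‖ ^ 2 ≤
      (∑ i ∈ Λ, ‖net.hd i‖) * ∑ i ∈ Λ, ‖net.hd i‖ * ‖x.2 i‖ ^ 2 := by
    rw [jointSignal, Finset.sum_coe_sort Λ (fun i => net.hd i * x.2 i)]
    exact norm_sum_mul_sq_le Λ net.hd x.2
  have hint : Integrable (fun x : Inputs N => (∑ i ∈ Λ, ‖net.hd i‖) *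
      ∑ i ∈ Λ, ‖net.hd i‖ * ‖x.2 i‖ ^ 2) (μ : Measure (Inputs N)) :=
    (integrable_finsetSum _ fun i _ => (hi i).1.const_mul _).const_mul _
  have hint' : Integrable (fun x => ‖net.jointSignal Λ (fun i => x.2 i)‖ ^ 2)
      (μ : Measure (Inputs N)) :=
    hint.mono' (hm.norm.pow_const 2).aestronglyMeasurable (ae_of_all _ fun x => by
      rw [Real.norm_of_nonneg (sq_nonneg _)]; exact hle x)
  refine ⟨hint', (integral_mono hint' hint hle).trans ?_⟩
  rw [integral_const_mul, integral_finsetSum _ fun i _ => (hi i).1.const_mul _, sq,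
    mul_left_comm, Finset.mul_sum (a := net.P)]
  refine mul_le_mul_of_nonneg_left (Finset.sum_le_sum fun i _ => ?_)
    (Finset.sum_nonneg fun i _ => norm_nonneg _)
  rw [integral_const_mul, mul_comm]
  exact mul_le_mul_of_nonneg_right (hi i).2 (norm_nonneg _)

theorem cutValue_le {μ : ProbabilityMeasure (Inputs N)} (hμ : net.MeetsPower μ) :
    net.cutValue μ Λ ≤
      ENNReal.ofReal (maxOver Λ net.Rd + maxOver Λᶜ net.Rs + beamformingGap N) := by
  obtain ⟨i1, e1⟩ := net.integral_jointSignal_le Λ hμ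
  obtain ⟨i2, e2⟩ := integral_norm_sq_le_of_lintegral (μ := (μ : Measure (Inputs N)))
    (f := fun x => x.1) measurable_fst net.P_pos.le hμ.1
  have hp : net.P * (∑ i ∈ Λ, ‖net.hd i‖) ^ 2 =
      (net.power * (∑ i ∈ Λ, ‖net.hd i‖₊) ^ 2 : ℝ≥0) := by
    push_cast; rw [coe_power]
  rw [hp] at e1
  rw [← net.coe_power] at e2
  refine (net.cutValue_le_of_moments Λ μ i1 i2 e1 e2).trans (ENNReal.ofReal_le_ofReal ?_)
  have h1 := logb_sq_sum_le Λ (fun i => ‖net.hd i‖) net.snr_pos fun i => norm_nonneg _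
  have h2 := logb_sum_sq_le Λᶜ (fun i => ‖net.hs i‖) net.snr_pos
  have h3 := logb_card_le_beamformingGap Λ
  have q1 : ((net.power * (∑ i ∈ Λ, ‖net.hd i‖₊) ^ 2 : ℝ≥0) : ℝ) / net.noiseVar =
      net.snr * (∑ i ∈ Λ, ‖net.hd i‖) ^ 2 := by
    rw [snr_eq]; push_cast; ring
  have q2 : (net.power : ℝ) * (∑ i : {i // i ∈ Λᶜ}, ‖net.hs i‖ ^ 2) / net.noiseVar =
      net.snr * ∑ i ∈ Λᶜ, ‖net.hs i‖ ^ 2 := by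
    rw [snr_eq, Finset.sum_coe_sort Λᶜ (fun i => ‖net.hs i‖ ^ 2)]; ring
  rw [q1, q2]
  change _ ≤ maxOver Λ net.Rd + _ at h1
  change _ ≤ maxOver Λᶜ net.Rs + _ at h2
  linarith

theorem le_cutValue_gaussianInputs :
    ENNReal.ofReal (maxOver Λ net.Rd + maxOver Λᶜ net.Rs) ≤
      net.cutValue net.gaussianInputs Λ := by
  rw [cutValue_gaussianInputs]
  refine ENNReal.ofReal_le_ofReal ?_
  have h1 := maxOver_logb_le Λ (fun i => ‖net.hd i‖) net.snr_pos
  have h2 := maxOver_logb_le Λᶜ (fun i => ‖net.hs i‖) net.snr_pos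
  have q1 : (net.jointPower Λ : ℝ) / net.noiseVar =
      net.snr * ∑ i ∈ Λ, ‖net.hd i‖ ^ 2 := by
    rw [snr_eq, jointPower, ← Finset.sum_coe_sort Λ (fun i => ‖net.hd i‖ ^ 2)]; push_cast; ring
  have q2 : (net.power : ℝ) * (∑ i : {i // i ∈ Λᶜ}, ‖net.hs i‖ ^ 2) / net.noiseVar =
      net.snr * ∑ i ∈ Λᶜ, ‖net.hs i‖ ^ 2 := by
    rw [snr_eq, Finset.sum_coe_sort Λᶜ (fun i => ‖net.hs i‖ ^ 2)]; ring
  rw [q1, q2]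
  exact add_le_add h1 h2

/-- A cut attaining `ω` does not depend on the input law, so it bounds the infimum for every
admissible law. -/
theorem cutSetBound_le :
    net.cutSetBound ≤ ENNReal.ofReal (net.omega + beamformingGap N) := by
  obtain ⟨Λ, -, hΛ⟩ := Finset.exists_mem_eq_inf' (Finset.univ_nonempty (α := Finset (Fin N)))
    fun Λ => maxOver Λ net.Rd + maxOver Λᶜ net.Rs
  rw [omega, hΛ]
  exact iSup₂_le fun μ hμ => (iInf_le _ Λ).trans (net.cutValue_le Λ hμ)

/-- One input law, independent Gaussians, serves all cuts at once, so the infimum over cuts stays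
above `ω`. -/
theorem omega_le_cutSetBound : ENNReal.ofReal net.omega ≤ net.cutSetBound := by
  refine le_trans (le_iInf fun Λ => ?_)
    (le_iSup₂ (f := fun μ _ => ⨅ Λ : Finset (Fin N), net.cutValue μ Λ) net.gaussianInputs
      net.meetsPower_gaussianInputs)
  exact (ENNReal.ofReal_le_ofReal (Finset.inf'_le _ (Finset.mem_univ Λ))).trans
    (net.le_cutValue_gaussianInputs Λ)

theorem maxOver_nonneg {R : Fin N → ℝ} (hR : ∀ i, 0 ≤ R i) : 0 ≤ maxOver Λ R := by
  rcases Λ.eq_empty_or_nonempty with rfl | hΛ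
  · rw [maxOver_empty]
  · obtain ⟨j, -, he, -⟩ := exists_mem_maxOver_eq hΛ R
    rw [he]; exact hR j

theorem omega_nonneg : 0 ≤ net.omega := by
  have h (c : ℂ) : 0 ≤ Real.logb 2 (1 + net.snr * ‖c‖ ^ 2) :=
    Real.logb_nonneg one_lt_two (by have := net.snr_pos; simp; positivity)
  exact Finset.le_inf' _ _ fun Λ _ =>
    add_nonneg (maxOver_nonneg _ fun i => h _) (maxOver_nonneg _ fun i => h _)

end DiamondNetwork

end

theorem mainTheorem6 (N : ℕ) (hN : 1 ≤ N) (net : DiamondNetwork N) :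
    net.cutSetBound ≠ ∞ ∧
      net.omega ≤ net.cutSetBound.toReal ∧
      net.cutSetBound.toReal ≤ net.omega + beamformingGap N := by
  have hle := net.cutSetBound_le
  have htop : net.cutSetBound ≠ ∞ := (hle.trans_lt ENNReal.ofReal_lt_top).ne
  -- Since `ENNReal.ofReal` truncates negative numbers, the real upper bound follows only once `ω +
  -- G` is known to be nonnegative.
  have hG : 0 ≤ beamformingGap N := le_max_of_le_right
    (mul_nonneg zero_le_two (Real.logb_nonneg one_lt_two (by exact_mod_cast hN)))
  exact ⟨htop, (ENNReal.ofReal_le_iff_le_toReal htop).1 net.omega_le_cutSetBound,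
    ENNReal.toReal_le_of_le_ofReal (add_nonneg net.omega_nonneg hG) hle⟩
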